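/- Let $a,\alpha,\beta>0$ and $c_o,b\in\mathbb R$. For an immersion $X:\Sigma\to\mathbb R^3$, of class $C^4$ up to the boundary, of a compact oriented surface $\Sigma$ with boundary, with mean curvature $H$ (half the sum of the principal curvatures), Gaussian curvature $K$, and boundary curvature $\kappa$ (the curvature of $X|_{\partial\Sigma}$ as a space curve), consider the Euler–Helfrich energy $$E[X]=\int_\Sigma\left(a(H+c_o)^2+bK\right)d\Sigma+\oint_{\partial\Sigma}\left(\alpha\kappa^2+\beta\right)ds .$$ Call $X$ *critical* for $E$ if $\frac{d}{dt}\big|_{t=0}E[X_t]=0$ for every $C^4$ variation $X_t$ of $X_0=X$ (with no condition imposed on $\partial\Sigma$), and *stable* if moreover $\frac{d^2}{dt^2}\big|_{t=0}E[X_t]\ge 0$ for every such variation. Let $X$ be an axially symmetric immersion of a closed disc, that is, the surface obtained by rotating about an axis a profile curve $\gamma(\sigma)=(r(\sigma),z(\sigma))$, $\sigma\in[0,\mathcal L]$, $\mathcal L>0$, parametrized by arc length, where $r\ge 0$ is the distance to the axis, $z$ is the height along the axis, and $r(0)=0$. Assume that $X$ is critical for $E$ and stable. If $\gamma'(\mathcal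 L)$ is vertical, i.e. $r'(\mathcal L)=0$, then the squared curvature $\mu^2=\|\gamma''\|^2$ of $\gamma$ is non-decreasing at $\sigma=\mathcal L$, i.e. it has a (left) derivative there and $$(\mu^2)'(\mathcal L)\ge 0 .$$ -/

import Mathlib

open Set MeasureTheory

noncomputable section

namespace EulerHelfrich

/-- The parameter plane. -/
abbrev Plane : Type := EuclideanSpace ℝ (Fin 2)

/-- Euclidean three-space. -/
abbrev Space : Type := EuclideanSpace ℝ (Fin 3)

/-- The point of the parameter plane with polar coordinates `(ρ, θ)`. -/
def polar (ρ θ : ℝ) : Plane := !₂[ρ * Real.cos θ, ρ * Real.sin θ]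

/-- The closed disc of radius `R` about the origin, the abstract surface `Σ`. -/
def disc (R : ℝ) : Set Plane := Metric.closedBall 0 R

/-- The vector product of `ℝ³`. -/
def cross (v w : Space) : Space := WithLp.toLp 2 (crossProduct v.ofLp w.ofLp)

/-- The partial derivative `∂ᵢ Y`. -/
def pd (i : Fin 2) (Y : Plane → Space) (p : Plane) : Space :=
  fderiv ℝ Y p (EuclideanSpace.single i 1)

/-- Coefficients `g i j = ∂ᵢY · ∂ⱼY` of the first fundamental form. -/
def firstForm (Y : Plane → Space) (p : Plane) (i j : Fin 2) : ℝ :=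
  inner ℝ (pd i Y p) (pd j Y p)

/-- The determinant of the first fundamental form. -/
def gramDet (Y : Plane → Space) (p : Plane) : ℝ :=
  firstForm Y p 0 0 * firstForm Y p 1 1 - firstForm Y p 0 1 ^ 2

/-- The unit normal `ν` determined by the orientation of the parameter plane. -/
def unitNormal (Y : Plane → Space) (p : Plane) : Space :=
  ‖cross (pd 0 Y p) (pd 1 Y p)‖⁻¹ • cross (pd 0 Y p) (pd 1 Y p)

/-- Coefficients `h i j = ∂ᵢ∂ⱼY · ν` of the second fundamental form. -/
def secondForm (Y : Plane → Space) (p : Plane) (i j : Fin 2) : ℝ :=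
  inner ℝ (pd i (pd j Y) p) (unitNormal Y p)

/-- The mean curvature, i.e. half the sum of the principal curvatures; it is `-1/R` on a sphere of
radius `R` with the outward pointing normal. -/
def meanCurvature (Y : Plane → Space) (p : Plane) : ℝ :=
  (secondForm Y p 0 0 * firstForm Y p 1 1 - 2 * secondForm Y p 0 1 * firstForm Y p 0 1
    + secondForm Y p 1 1 * firstForm Y p 0 0) / (2 * gramDet Y p)

/-- The Gaussian curvature, i.e. the product of the principal curvatures. -/
def gaussCurvature (Y : Plane → Space) (p : Plane) : ℝ :=
  (secondForm Y p 0 0 * secondForm Y p 1 1 - secondForm Y p 0 1 ^ 2) / gramDet Y p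

/-- The square of the curvature of the (regular, arbitrarily parametrized) space curve `C`, that
is `‖C' × C''‖² / ‖C'‖⁶`. -/
def curvatureSq (C : ℝ → Space) (θ : ℝ) : ℝ :=
  ‖cross (deriv C θ) (deriv (deriv C) θ)‖ ^ 2 / ‖deriv C θ‖ ^ 6

/-- The image under `Y` of the boundary circle of the disc of radius `R`. -/
def boundaryCurve (R : ℝ) (Y : Plane → Space) (θ : ℝ) : Space := Y (polar R θ)

/-- The Euler-Helfrich energy
`∫_Σ (a (H + c₀)² + b K) dΣ + ∮_∂Σ (α κ² + β) ds` of the immersion of the disc of radius `R`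
obtained by restricting `Y`. -/
def energy (a c₀ b α β R : ℝ) (Y : Plane → Space) : ℝ :=
  (∫ p in disc R, (a * (meanCurvature Y p + c₀) ^ 2 + b * gaussCurvature Y p)
      * Real.sqrt (gramDet Y p))
    + ∫ θ in (0 : ℝ)..(2 * Real.pi),
        (α * curvatureSq (boundaryCurve R Y) θ + β) * ‖deriv (boundaryCurve R Y) θ‖

/-- An immersion of the closed disc of radius `R`, of class `C⁴` up to the boundary (the restriction
to the disc of a `C⁴` map of the plane). -/
structure IsImmersedDisc (R : ℝ) (X : Plane → Space) : Prop where
  pos : 0 < R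
  contDiff : ContDiff ℝ 4 X
  immersion : ∀ p ∈ disc R, Function.Injective (fderiv ℝ X p)

/-- A `C⁴` variation `Y t` of `X` on the disc of radius `R`. Nothing is prescribed on the boundary
of the disc. -/
structure IsVariation (R : ℝ) (X : Plane → Space) (Y : ℝ → Plane → Space) : Prop where
  contDiff : ContDiff ℝ 4 (fun q : ℝ × Plane => Y q.1 q.2)
  base : ∀ p ∈ disc R, Y 0 p = X p

/-- `X` is critical for the energy: the first variation vanishes for all variations. -/
def IsCritical (a c₀ b α β R : ℝ) (X : Plane → Space) : Prop :=
  ∀ Y : ℝ → Plane → Space, IsVariation R X Y →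
    HasDerivAt (fun t : ℝ => energy a c₀ b α β R (Y t)) 0 0

/-- `X` is stable for the energy: the second variation is nonnegative for all variations. -/
def IsStable (a c₀ b α β R : ℝ) (X : Plane → Space) : Prop :=
  ∀ Y : ℝ → Plane → Space, IsVariation R X Y →
    0 ≤ iteratedDeriv 2 (fun t : ℝ => energy a c₀ b α β R (Y t)) 0

/-- `X` is the axially symmetric disc with profile curve `γ = (r, z)` on `[0, L]`: the curve `γ` is
parametrized by arc length and runs in the half-plane `r ≥ 0`, and `X` is obtained by rotating it
about the line through `q` with direction `e 2`, where `e` is an orthonormal basis of `ℝ³`. The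
parameter domain is the disc of radius `L`, with polar coordinates `(σ, θ)`: arc length along the
profile and angle of rotation. -/
structure IsAxiallySymmetricDisc (L : ℝ) (γ : ℝ → Plane) (X : Plane → Space) : Prop where
  immersed : IsImmersedDisc L X
  halfPlane : ∀ σ ∈ Icc 0 L, 0 ≤ γ σ 0
  arcLength : ∀ σ ∈ Icc 0 L, ‖derivWithin γ (Icc 0 L) σ‖ = 1
  rotation : ∃ (q : Space) (e : OrthonormalBasis (Fin 3) ℝ Space),
    ∀ σ ∈ Icc 0 L, ∀ θ : ℝ,
      X (polar σ θ) =
        q + (γ σ 0 * Real.cos θ) • e 0 + (γ σ 0 * Real.sin θ) • e 1 + (γ σ 1) • e 2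

/-- The squared curvature `μ²` of a curve `γ` parametrized by arc length on `[0, L]`. -/
def profileCurvatureSq (L : ℝ) (γ : ℝ → Plane) (σ : ℝ) : ℝ :=
  ‖derivWithin (derivWithin γ (Icc 0 L)) (Icc 0 L) σ‖ ^ 2

end EulerHelfrich

end

open Set MeasureTheory

noncomputable section

namespace EulerHelfrich

/-! Only variations through surfaces that are rotationally symmetric near the boundary are needed.
Write the profile as `(ρ, ζ)`, extended as a `C⁴` curve beyond `L`. If a variation fixes the inner
part of the disc and changes only the profile near the boundary circle, the energy is a constant
plus `2π (∫ lagr + α / ρ + β ρ)`, with the last two terms taken at the end point. Here `lagr` is a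
second order Lagrangian in one variable (`energy_axialVariation`). Two families of such variations
suffice.

Criticality is applied to `ρ + tψ`, with `ζ` kept. Integration by parts gives two natural boundary
conditions (`natural_boundary_conditions`). Where the profile is vertical one has `ρ' = 0`, `ζ'² =
1` and `ζ'' = 0`, and the conditions become (A) the vanishing of `a/2 (-ζ'ρ''ρ + ζ') ± a c₀ ρ + b
ζ'`, and (B) `β - α/ρ² = (a/2) ρ ρ'''` (`boundary_conditions`).

Stability is applied to sliding the boundary along the extended profile, `s ↦ s + tη(s)` with `η =
1` near `L`. Since `lagr` transforms as a density under reparametrization (`lagr_reparam`), the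
reduced energy is that of the same curve stopped at `L + t`. Its second derivative at `t = 0` is, up
to the factor `2π`, `f'(L) + (β - α/ρ²) ρ''`, where `f` is `lagr` along the profile
(`second_variation`). Now `f'(L)` is `-ζ'ρ'''` times the expression in (A), hence zero. With (B),
stability says `(a/2) ρ ρ'' ρ''' ≥ 0`, while `(μ²)'(L) = 2 ρ'' ρ'''`. -/

/-! ### Orthonormal frames and the vector product. -/

/-- The vector with coordinates `(x, y, z)` in the frame `e`. -/
def comb (e : OrthonormalBasis (Fin 3) ℝ Space) (x y z : ℝ) : Space :=
  x • e 0 + y • e 1 + z • e 2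

theorem inner_comb (e : OrthonormalBasis (Fin 3) ℝ Space) (x y z x' y' z' : ℝ) :
    inner ℝ (comb e x y z) (comb e x' y' z') = x * x' + y * y' + z * z' := by
  have h : ∀ i j, inner ℝ (e i) (e j) = if i = j then (1 : ℝ) else 0 :=
    fun i j => orthonormal_iff_ite.1 e.orthonormal i j
  simp [comb, inner_add_left, inner_add_right, inner_smul_left, inner_smul_right, h]
  ring

theorem norm_sq_comb (e : OrthonormalBasis (Fin 3) ℝ Space) (x y z : ℝ) :
    ‖comb e x y z‖ ^ 2 = x ^ 2 + y ^ 2 + z ^ 2 := by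
  rw [← real_inner_self_eq_norm_sq, inner_comb]
  ring

theorem inner_eq_sum (v w : Space) : inner ℝ v w = v 0 * w 0 + v 1 * w 1 + v 2 * w 2 := by
  rw [PiLp.inner_apply, Fin.sum_univ_three]
  simp [mul_comm]

theorem cross_apply_zero (v w : Space) : cross v w 0 = v 1 * w 2 - v 2 * w 1 := by
  simp [cross, crossProduct]

theorem cross_apply_one (v w : Space) : cross v w 1 = v 2 * w 0 - v 0 * w 2 := by
  simp [cross, crossProduct]

theorem cross_apply_two (v w : Space) : cross v w 2 = v 0 * w 1 - v 1 * w 0 := by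
  simp [cross, crossProduct]

theorem norm_sq_cross (v w : Space) :
    ‖cross v w‖ ^ 2 = inner ℝ v v * inner ℝ w w - inner ℝ v w ^ 2 := by
  rw [← real_inner_self_eq_norm_sq]
  simp only [inner_eq_sum, cross_apply_zero, cross_apply_one, cross_apply_two]
  ring

theorem inner_cross_cyclic (u v w : Space) :
    inner ℝ u (cross v w) = inner ℝ v (cross w u) := by
  simp only [inner_eq_sum, cross_apply_zero, cross_apply_one, cross_apply_two]
  ring

/-- Each product is orthogonal to both factors, hence a multiple of the third vector. The three
multiples agree because the triple product is cyclic, and Lagrange's identity makes its square 1.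
The sign stays free since the axis frame may have either orientation. -/
theorem cross_orthonormalBasis (e : OrthonormalBasis (Fin 3) ℝ Space) :
    ∃ δ : ℝ, δ ^ 2 = 1 ∧ cross (e 0) (e 1) = δ • e 2 ∧ cross (e 1) (e 2) = δ • e 0 ∧
      cross (e 2) (e 0) = δ • e 1 := by
  have h : ∀ i j, inner ℝ (e i) (e j) = if i = j then (1 : ℝ) else 0 :=
    fun i j => orthonormal_iff_ite.1 e.orthonormal i j
  have hl : ∀ v w : Space, inner ℝ v (cross v w) = 0 := fun v w => by
    simp only [inner_eq_sum, cross_apply_zero, cross_apply_one, cross_apply_two]; ring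
  have hr : ∀ v w : Space, inner ℝ w (cross v w) = 0 := fun v w => by
    simp only [inner_eq_sum, cross_apply_zero, cross_apply_one, cross_apply_two]; ring
  have expand : ∀ v : Space, v = inner ℝ (e 0) v • e 0 + inner ℝ (e 1) v • e 1 +
      inner ℝ (e 2) v • e 2 := fun v => by
    conv_lhs => rw [← e.sum_repr' v, Fin.sum_univ_three]
  have h12 : cross (e 1) (e 2) = inner ℝ (e 0) (cross (e 1) (e 2)) • e 0 := by
    conv_lhs => rw [expand (cross (e 1) (e 2)), hl, hr]
    simp
  have h20 : cross (e 2) (e 0) = inner ℝ (e 0) (cross (e 1) (e 2)) • e 1 := by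
    conv_lhs => rw [expand (cross (e 2) (e 0)), hl, hr]
    rw [inner_cross_cyclic (e 0)]
    simp
  have h01 : cross (e 0) (e 1) = inner ℝ (e 0) (cross (e 1) (e 2)) • e 2 := by
    conv_lhs => rw [expand (cross (e 0) (e 1)), hl, hr]
    rw [inner_cross_cyclic (e 0), inner_cross_cyclic (e 1)]
    simp
  refine ⟨_, ?_, h01, h12, h20⟩
  have hn := norm_sq_cross (e 1) (e 2)
  rw [h12] at hn
  simpa [norm_smul, h] using hn

/-- The determinant `±1` of an orthonormal frame. -/
def frameSign (e : OrthonormalBasis (Fin 3) ℝ Space) : ℝ := (cross_orthonormalBasis e).choose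

theorem frameSign_sq (e : OrthonormalBasis (Fin 3) ℝ Space) : frameSign e ^ 2 = 1 :=
  (cross_orthonormalBasis e).choose_spec.1

theorem cross_comb (e : OrthonormalBasis (Fin 3) ℝ Space) (x y z x' y' z' : ℝ) :
    cross (comb e x y z) (comb e x' y' z') =
      frameSign e • comb e (y * z' - z * y') (z * x' - x * z') (x * y' - y * x') := by
  obtain ⟨-, h01, h12, h20⟩ := (cross_orthonormalBasis e).choose_spec
  have key : cross (comb e x y z) (comb e x' y' z') =
      (y * z' - z * y') • cross (e 1) (e 2) + (z * x' - x * z') • cross (e 2) (e 0)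
        + (x * y' - y * x') • cross (e 0) (e 1) := by
    ext i
    fin_cases i
    · simp [cross_apply_zero, comb]; ring
    · simp [cross_apply_one, comb]; ring
    · simp [cross_apply_two, comb]; ring
  change cross (e 0) (e 1) = frameSign e • e 2 at h01
  change cross (e 1) (e 2) = frameSign e • e 0 at h12
  change cross (e 2) (e 0) = frameSign e • e 1 at h20
  rw [key, h01, h12, h20]
  simp only [comb, smul_add, smul_smul]
  ring_nf

/-! ### Partial derivatives of rotationally symmetric maps. -/

/-- The partial derivative of a real function on the plane. -/
def pds (i : Fin 2) (f : Plane → ℝ) (p : Plane) : ℝ := fderiv ℝ f p (EuclideanSpace.single i 1)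

theorem pd_comb (e : OrthonormalBasis (Fin 3) ℝ Space) (q : Space) {f g h : Plane → ℝ} {p : Plane}
    (hf : DifferentiableAt ℝ f p) (hg : DifferentiableAt ℝ g p) (hh : DifferentiableAt ℝ h p)
    (i : Fin 2) :
    pd i (fun p => q + comb e (f p) (g p) (h p)) p =
      comb e (pds i f p) (pds i g p) (pds i h p) := by
  have := (((hf.hasFDerivAt.smul_const (e 0)).add (hg.hasFDerivAt.smul_const (e 1))).add
    (hh.hasFDerivAt.smul_const (e 2))).const_add q
  rw [pd]
  unfold comb
  erw [this.fderiv]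
  simp [pds]

theorem pd_congr {Y Y' : Plane → Space} {p : Plane} (h : Y =ᶠ[nhds p] Y') (i : Fin 2) :
    pd i Y =ᶠ[nhds p] pd i Y' := by
  filter_upwards [h.fderiv (𝕜 := ℝ)] with x hx
  rw [pd, pd, hx]

/-- The squared distance to the origin of the parameter plane. -/
def usq (p : Plane) : ℝ := p 0 ^ 2 + p 1 ^ 2

theorem norm_sq_eq_usq (p : Plane) : ‖p‖ ^ 2 = usq p := by
  rw [EuclideanSpace.norm_sq_eq, Fin.sum_univ_two]
  simp [usq]

theorem norm_eq_sqrt_usq (p : Plane) : ‖p‖ = √(usq p) := by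
  rw [← norm_sq_eq_usq, Real.sqrt_sq (norm_nonneg p)]

theorem hasFDerivAt_coord (i : Fin 2) (p : Plane) :
    HasFDerivAt (fun p : Plane => p i) (EuclideanSpace.proj i : Plane →L[ℝ] ℝ) p :=
  (EuclideanSpace.proj i : Plane →L[ℝ] ℝ).hasFDerivAt

theorem hasFDerivAt_comp_usq {A : ℝ → ℝ} {A₁ : ℝ} {p : Plane} (hA : HasDerivAt A A₁ (usq p)) :
    HasFDerivAt (fun p => A (usq p))
      (A₁ • ((2 * p 0) • (EuclideanSpace.proj 0 : Plane →L[ℝ] ℝ)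
        + (2 * p 1) • (EuclideanSpace.proj 1 : Plane →L[ℝ] ℝ))) p := by
  have hu : HasFDerivAt usq ((2 * p 0) • (EuclideanSpace.proj 0 : Plane →L[ℝ] ℝ)
        + (2 * p 1) • (EuclideanSpace.proj 1 : Plane →L[ℝ] ℝ)) p := by
    have := ((hasFDerivAt_coord 0 p).pow 2).add ((hasFDerivAt_coord 1 p).pow 2)
    exact this.congr_fderiv (by ext v; simp)
  exact hA.comp_hasFDerivAt p hu

/-- The rotationally symmetric map `(x, y) ↦ q + A(u) (x e₀ + y e₁) + B(u) e₂`,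
`u = x² + y²`. -/
def rotMap (q : Space) (e : OrthonormalBasis (Fin 3) ℝ Space) (A B : ℝ → ℝ) (p : Plane) : Space :=
  q + comb e (A (usq p) * p 0) (A (usq p) * p 1) (B (usq p))

theorem pds_eq {f : Plane → ℝ} {f' : Plane →L[ℝ] ℝ} {p : Plane} (h : HasFDerivAt f f' p)
    (i : Fin 2) : pds i f p = f' (EuclideanSpace.single i 1) := by
  rw [pds, h.fderiv]

section
variable {q : Space} {e : OrthonormalBasis (Fin 3) ℝ Space} {A B : ℝ → ℝ} {a₁ b₁ a₂ b₂ : ℝ}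
  {p : Plane}

theorem pd_zero_rotMap (hA : HasDerivAt A a₁ (usq p)) (hB : HasDerivAt B b₁ (usq p)) :
    pd 0 (rotMap q e A B) p =
      comb e (A (usq p) + 2 * a₁ * p 0 ^ 2) (2 * a₁ * p 0 * p 1) (2 * b₁ * p 0) := by
  have h0 := (hasFDerivAt_comp_usq hA).mul (hasFDerivAt_coord 0 p)
  have h1 := (hasFDerivAt_comp_usq hA).mul (hasFDerivAt_coord 1 p)
  have h2 := hasFDerivAt_comp_usq hB
  refine (pd_comb e q h0.differentiableAt h1.differentiableAt h2.differentiableAt 0).trans ?_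
  congr 1
  · refine (pds_eq h0 0).trans ?_
    simp; ring
  · refine (pds_eq h1 0).trans ?_
    simp; ring
  · refine (pds_eq h2 0).trans ?_
    simp; ring

theorem pd_one_rotMap (hA : HasDerivAt A a₁ (usq p)) (hB : HasDerivAt B b₁ (usq p)) :
    pd 1 (rotMap q e A B) p =
      comb e (2 * a₁ * p 0 * p 1) (A (usq p) + 2 * a₁ * p 1 ^ 2) (2 * b₁ * p 1) := by
  have h0 := (hasFDerivAt_comp_usq hA).mul (hasFDerivAt_coord 0 p)
  have h1 := (hasFDerivAt_comp_usq hA).mul (hasFDerivAt_coord 1 p)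
  have h2 := hasFDerivAt_comp_usq hB
  refine (pd_comb e q h0.differentiableAt h1.differentiableAt h2.differentiableAt 1).trans ?_
  congr 1
  · refine (pds_eq h0 1).trans ?_
    simp; ring
  · refine (pds_eq h1 1).trans ?_
    simp; ring
  · refine (pds_eq h2 1).trans ?_
    simp; ring

theorem continuous_usq : Continuous usq := by
  unfold usq; fun_prop

/-- In terms of `u = x² + y²` all second derivatives are polynomial in `x`, `y` and the derivatives
of `A` and `B`, so no angles or square roots enter the curvature computation. -/
theorem pd_pd_rotMap (hA : ∀ᶠ u in nhds (usq p), DifferentiableAt ℝ A u)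
    (hB : ∀ᶠ u in nhds (usq p), DifferentiableAt ℝ B u)
    (hA₁ : HasDerivAt (deriv A) a₂ (usq p)) (hB₁ : HasDerivAt (deriv B) b₂ (usq p)) :
    pd 0 (pd 0 (rotMap q e A B)) p =
      comb e (6 * deriv A (usq p) * p 0 + 4 * a₂ * p 0 ^ 3)
        (2 * deriv A (usq p) * p 1 + 4 * a₂ * p 0 ^ 2 * p 1)
        (2 * deriv B (usq p) + 4 * b₂ * p 0 ^ 2) ∧
    pd 0 (pd 1 (rotMap q e A B)) p =
      comb e (2 * deriv A (usq p) * p 1 + 4 * a₂ * p 0 ^ 2 * p 1)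
        (2 * deriv A (usq p) * p 0 + 4 * a₂ * p 0 * p 1 ^ 2)
        (4 * b₂ * p 0 * p 1) ∧
    pd 1 (pd 1 (rotMap q e A B)) p =
      comb e (2 * deriv A (usq p) * p 0 + 4 * a₂ * p 0 * p 1 ^ 2)
        (6 * deriv A (usq p) * p 1 + 4 * a₂ * p 1 ^ 3)
        (2 * deriv B (usq p) + 4 * b₂ * p 1 ^ 2) := by
  have hev : ∀ᶠ p' in nhds p, DifferentiableAt ℝ A (usq p') ∧ DifferentiableAt ℝ B (usq p') :=
    continuous_usq.continuousAt.eventually (hA.and hB)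
  have e0 : pd 0 (rotMap q e A B) =ᶠ[nhds p] fun p => 0 +
      comb e (A (usq p) + 2 * deriv A (usq p) * p 0 ^ 2) (2 * deriv A (usq p) * p 0 * p 1)
        (2 * deriv B (usq p) * p 0) := by
    filter_upwards [hev] with p' hp'
    rw [zero_add, pd_zero_rotMap hp'.1.hasDerivAt hp'.2.hasDerivAt]
  have e1 : pd 1 (rotMap q e A B) =ᶠ[nhds p] fun p => 0 +
      comb e (2 * deriv A (usq p) * p 0 * p 1) (A (usq p) + 2 * deriv A (usq p) * p 1 ^ 2)
        (2 * deriv B (usq p) * p 1) := by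
    filter_upwards [hev] with p' hp'
    rw [zero_add, pd_one_rotMap hp'.1.hasDerivAt hp'.2.hasDerivAt]
  have hx := hasFDerivAt_coord 0 p
  have hy := hasFDerivAt_coord 1 p
  have hA0 := hasFDerivAt_comp_usq hA.self_of_nhds.hasDerivAt
  have hA2 := (hasFDerivAt_comp_usq hA₁).const_mul 2
  have hB2 := (hasFDerivAt_comp_usq hB₁).const_mul 2
  have c00 := hA0.add (hA2.mul (hx.pow 2))
  have c01 := (hA2.mul hx).mul hy
  have c11 := hA0.add (hA2.mul (hy.pow 2))
  have c02 := hB2.mul hx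
  have c12 := hB2.mul hy
  refine ⟨?_, ?_, ?_⟩
  · rw [(pd_congr e0 0).eq_of_nhds]
    refine (pd_comb e 0 c00.differentiableAt c01.differentiableAt c02.differentiableAt 0).trans ?_
    congr 1
    · refine (pds_eq c00 0).trans ?_
      simp; ring
    · refine (pds_eq c01 0).trans ?_
      simp; ring
    · refine (pds_eq c02 0).trans ?_
      simp; ring
  · rw [(pd_congr e1 0).eq_of_nhds]
    refine (pd_comb e 0 c01.differentiableAt c11.differentiableAt c12.differentiableAt 0).trans ?_
    congr 1
    · refine (pds_eq c01 0).trans ?_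
      simp; ring
    · refine (pds_eq c11 0).trans ?_
      simp; ring
    · refine (pds_eq c12 0).trans ?_
      simp; ring
  · rw [(pd_congr e1 1).eq_of_nhds]
    refine (pd_comb e 0 c01.differentiableAt c11.differentiableAt c12.differentiableAt 1).trans ?_
    congr 1
    · refine (pds_eq c01 1).trans ?_
      simp; ring
    · refine (pds_eq c11 1).trans ?_
      simp; ring
    · refine (pds_eq c12 1).trans ?_
      simp; ring

end

/-! ### The reduced Lagrangian. -/

/-- The density of the Helfrich energy with respect to the area of the parameter plane. -/
def helfrichDensity (a c₀ b : ℝ) (Y : Plane → Space) (p : Plane) : ℝ :=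
  (a * (meanCurvature Y p + c₀) ^ 2 + b * gaussCurvature Y p) * Real.sqrt (gramDet Y p)

/-- The density depends on derivatives up to order two, so agreement of germs is required; this
governs how surfaces are glued below. -/
theorem helfrichDensity_congr {a c₀ b : ℝ} {Y Y' : Plane → Space} {p : Plane}
    (h : Y =ᶠ[nhds p] Y') : helfrichDensity a c₀ b Y p = helfrichDensity a c₀ b Y' p := by
  have h1 : ∀ i, pd i Y p = pd i Y' p := fun i => (pd_congr h i).eq_of_nhds
  have h2 : ∀ i j, pd i (pd j Y) p = pd i (pd j Y') p :=
    fun i j => (pd_congr (pd_congr h j) i).eq_of_nhds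
  simp only [helfrichDensity, meanCurvature, gaussCurvature, gramDet, secondForm, firstForm,
    unitNormal, h1, h2]

theorem norm_cross_pd (Y : Plane → Space) (p : Plane) :
    ‖cross (pd 0 Y p) (pd 1 Y p)‖ ^ 2 = gramDet Y p := by
  rw [norm_sq_cross]; rfl

/-- The reduced Lagrangian of the Helfrich energy for a surface of revolution with profile
`(r, z)`; the arguments are `r`, `p = r'`, `d = r''`, `y = z'`, `e = z''`. -/
def lagr (a c b r p d y e : ℝ) : ℝ :=
  a / 4 * (((p * e - y * d) * r + y * (p ^ 2 + y ^ 2)) ^ 2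
      / (r * ((p ^ 2 + y ^ 2) ^ 2 * √(p ^ 2 + y ^ 2))))
    + a * c * ((p * e - y * d) * r / (p ^ 2 + y ^ 2) + y)
    + a * c ^ 2 * (r * √(p ^ 2 + y ^ 2))
    + b * ((p * e - y * d) * y / ((p ^ 2 + y ^ 2) * √(p ^ 2 + y ^ 2)))

/-- The profile is `r = s A(s²)`, `z = B(s²)`. The factor `1 / s` will cancel the polar Jacobian.
The orientation of the frame changes the sign of `H` but not of `K`, so it can be absorbed into
`c₀`. -/
theorem helfrichDensity_rotMap (a c₀ b : ℝ) {q : Space} {e : OrthonormalBasis (Fin 3) ℝ Space}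
    {A B : ℝ → ℝ} {a₂ b₂ : ℝ} {p : Plane} (hA : ∀ᶠ u in nhds (usq p), DifferentiableAt ℝ A u)
    (hB : ∀ᶠ u in nhds (usq p), DifferentiableAt ℝ B u)
    (hA₁ : HasDerivAt (deriv A) a₂ (usq p)) (hB₁ : HasDerivAt (deriv B) b₂ (usq p))
    {s r r₁ r₂ z₁ z₂ : ℝ} (hs : 0 < s) (hu : usq p = s ^ 2) (hr : r = s * A (usq p))
    (hr₁ : r₁ = A (usq p) + 2 * s ^ 2 * deriv A (usq p))
    (hr₂ : r₂ = 6 * s * deriv A (usq p) + 4 * s ^ 3 * a₂)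
    (hz₁ : z₁ = 2 * s * deriv B (usq p))
    (hz₂ : z₂ = 2 * deriv B (usq p) + 4 * s ^ 2 * b₂)
    (hrpos : 0 < r) (hw : 0 < r₁ ^ 2 + z₁ ^ 2) :
    helfrichDensity a c₀ b (rotMap q e A B) p =
      lagr a (frameSign e * c₀) b r r₁ r₂ z₁ z₂ / s := by
  have h0 := pd_zero_rotMap (q := q) (e := e) hA.self_of_nhds.hasDerivAt hB.self_of_nhds.hasDerivAt
  have h1 := pd_one_rotMap (q := q) (e := e) hA.self_of_nhds.hasDerivAt hB.self_of_nhds.hasDerivAt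
  obtain ⟨h00, h01, h11⟩ := pd_pd_rotMap (q := q) (e := e) hA hB hA₁ hB₁
  have hδ := frameSign_sq e
  have hxy : p 0 ^ 2 + p 1 ^ 2 = s ^ 2 := hu
  have hg := norm_cross_pd (rotMap q e A B) p
  set N := ‖cross (pd 0 (rotMap q e A B) p) (pd 1 (rotMap q e A B) p)‖ with hN
  set x := p 0
  set y := p 1
  set α := A (usq p)
  set α₁ := deriv A (usq p)
  set β₁ := deriv B (usq p)
  set δ := frameSign e
  have hαpos : 0 < α := by
    rw [hr] at hrpos
    exact pos_of_mul_pos_right hrpos hs.le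
  set w := r₁ ^ 2 + z₁ ^ 2 with hwdef
  have hs2 : s ^ 2 = x ^ 2 + y ^ 2 := hxy.symm
  have hw' : w = (α + 2 * (x ^ 2 + y ^ 2) * α₁) ^ 2 + 4 * (x ^ 2 + y ^ 2) * β₁ ^ 2 := by
    rw [hwdef, hr₁, hz₁, ← hs2]; ring
  set D := r₁ * z₂ - z₁ * r₂ with hDdef
  have hD' : D = (α + 2 * (x ^ 2 + y ^ 2) * α₁) * (2 * β₁ + 4 * (x ^ 2 + y ^ 2) * b₂)
      - (12 * (x ^ 2 + y ^ 2) * β₁ * α₁ + 8 * (x ^ 2 + y ^ 2) ^ 2 * β₁ * a₂) := by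
    rw [hDdef, hr₁, hz₁, hr₂, hz₂, ← hs2]; ring
  have hgram : gramDet (rotMap q e A B) p = α ^ 2 * w := by
    rw [gramDet, firstForm, firstForm, firstForm, h0, h1]
    simp only [inner_comb]
    rw [hw']
    ring
  have hNval : N = α * √w := by
    have h2 : N ^ 2 = (α * √w) ^ 2 := by rw [hg, hgram, mul_pow, Real.sq_sqrt hw.le]
    exact (pow_left_inj₀ (norm_nonneg _) (by positivity) two_ne_zero).1 h2
  have hQ : 0 < √w := Real.sqrt_pos.2 hw
  have hQ2 : √w ^ 2 = w := Real.sq_sqrt hw.le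
  have hsqrt : √(gramDet (rotMap q e A B) p) = α * √w := by
    rw [hgram, Real.sqrt_mul (by positivity), Real.sqrt_sq hαpos.le]
  have hH : meanCurvature (rotMap q e A B) p =
      δ * (D * α + 2 * β₁ * w) / (2 * α * (w * √w)) := by
    rw [meanCurvature, hgram]
    simp only [secondForm, firstForm, unitNormal, inner_smul_right]
    rw [← hN, hNval, h00, h01, h11, h0, h1]
    simp only [cross_comb, inner_smul_right, inner_comb]
    rw [div_eq_div_iff (by positivity) (by positivity)]
    field_simp
    rw [hD', hw']
    ring
  have hK : gaussCurvature (rotMap q e A B) p = 2 * β₁ * D / (α * w ^ 2) := by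
    rw [gaussCurvature, hgram]
    simp only [secondForm, unitNormal, inner_smul_right]
    rw [← hN, hNval, h00, h01, h11, h0, h1]
    simp only [cross_comb, inner_smul_right, inner_comb]
    rw [div_eq_div_iff (by positivity) (by positivity)]
    field_simp
    rw [hQ2]
    change frameSign e ^ 2 = 1 at hδ
    rw [hδ, hD', hw']
    ring
  rw [helfrichDensity, hH, hK, hsqrt, lagr, ← hDdef, ← hwdef, hr, hz₁]
  -- Since `δ² = 1`, the sign moves from the curvature to `c₀` under the square.
  have hc : (δ * (D * α + 2 * β₁ * w) / (2 * α * (w * √w)) + c₀) ^ 2 =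
      ((D * α + 2 * β₁ * w) / (2 * α * (w * √w)) + δ * c₀) ^ 2 := by
    linear_combination (((D * α + 2 * β₁ * w) / (2 * α * (w * √w))) ^ 2 - c₀ ^ 2) * hδ
  rw [hc]
  generalize √w = Q at *
  rw [← hQ2]
  field_simp
  ring

/-- The surface of revolution with profile `s ↦ (R s, Z s)`, `s` being the distance to the
origin in the parameter plane. -/
def rotProfile (q : Space) (e : OrthonormalBasis (Fin 3) ℝ Space) (R Z : ℝ → ℝ) (p : Plane) :
    Space :=
  q + comb e (R ‖p‖ / ‖p‖ * p 0) (R ‖p‖ / ‖p‖ * p 1) (Z ‖p‖)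

/-- The reduced Lagrangian along the profile `(R, Z)`. -/
def lagrAlong (a c b : ℝ) (R Z : ℝ → ℝ) (s : ℝ) : ℝ :=
  lagr a c b (R s) (deriv R s) (deriv (deriv R) s) (deriv Z s) (deriv (deriv Z) s)

/-- Away from the origin `A(u) = R(√u)/√u` and `B(u) = Z(√u)` are smooth enough for the previous
computation; the chain rule translates their derivatives back to those of `R` and `Z`. -/
theorem helfrichDensity_rotProfile (a c₀ b : ℝ) {q : Space}
    {e : OrthonormalBasis (Fin 3) ℝ Space} {R Z : ℝ → ℝ} (hR : ContDiff ℝ 4 R)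
    (hZ : ContDiff ℝ 4 Z) {p : Plane} (hp : p ≠ 0) (hpos : 0 < R ‖p‖)
    (hw : 0 < deriv R ‖p‖ ^ 2 + deriv Z ‖p‖ ^ 2) :
    helfrichDensity a c₀ b (rotProfile q e R Z) p =
      lagrAlong a (frameSign e * c₀) b R Z ‖p‖ / ‖p‖ := by
  set A : ℝ → ℝ := fun u => R √u / √u with hAdef
  set B : ℝ → ℝ := fun u => Z √u with hBdef
  have hs : 0 < ‖p‖ := norm_pos_iff.2 hp
  have hu := norm_sq_eq_usq p
  have hupos : 0 < usq p := by rw [← hu]; positivity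
  have hrot : rotProfile q e R Z = rotMap q e A B := by
    funext p'
    simp only [rotProfile, rotMap, hAdef, hBdef, norm_eq_sqrt_usq]
  have hsq : ∀ u : ℝ, 0 < u → ContDiffAt ℝ 2 Real.sqrt u :=
    fun u hu => Real.contDiffAt_sqrt hu.ne'
  have hAc : ∀ u : ℝ, 0 < u → ContDiffAt ℝ 2 A u := fun u hu =>
    (((hR.of_le (by norm_num)).contDiffAt).comp u (hsq u hu)).div (hsq u hu)
      (Real.sqrt_pos.2 hu).ne'
  have hBc : ∀ u : ℝ, 0 < u → ContDiffAt ℝ 2 B u := fun u hu =>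
    ((hZ.of_le (by norm_num)).contDiffAt).comp u (hsq u hu)
  have hd1 : ∀ {F : ℝ → ℝ}, (∀ u : ℝ, 0 < u → ContDiffAt ℝ 2 F u) → ∀ u : ℝ, 0 < u →
      HasDerivAt F (deriv F u) u :=
    fun hF u hu => ((hF u hu).differentiableAt (by norm_num)).hasDerivAt
  have hd2 : ∀ {F : ℝ → ℝ}, (∀ u : ℝ, 0 < u → ContDiffAt ℝ 2 F u) → ∀ u : ℝ, 0 < u →
      HasDerivAt (deriv F) (deriv (deriv F) u) u := fun hF u hu => by
    have h : DifferentiableAt ℝ (fun u => fderiv ℝ _ u 1) u :=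
      (((hF u hu).fderiv_right (m := 1) (by norm_num)).differentiableAt (by norm_num)).clm_apply
        (differentiableAt_const 1)
    exact h.hasDerivAt
  have hev : ∀ᶠ u in nhds (usq p), 0 < u := lt_mem_nhds hupos
  have hpow : ∀ s : ℝ, HasDerivAt (fun s : ℝ => s ^ 2) (2 * s) s := fun s => by
    simpa using hasDerivAt_pow 2 s
  have hRA : ∀ s : ℝ, 0 < s → R s = s * A (s ^ 2) := fun s hs => by
    simp only [hAdef, Real.sqrt_sq hs.le]
    field_simp
  have hZB : ∀ s : ℝ, 0 < s → Z s = B (s ^ 2) := fun s hs => by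
    simp only [hBdef, Real.sqrt_sq hs.le]
  have hR1 : ∀ s : ℝ, 0 < s → deriv R s = A (s ^ 2) + 2 * s ^ 2 * deriv A (s ^ 2) := fun s hs => by
    have h := (hasDerivAt_id s).mul ((hd1 hAc (s ^ 2) (by positivity)).comp s (hpow s))
    have he : R =ᶠ[nhds s] id * (A ∘ fun s => s ^ 2) := by
      filter_upwards [lt_mem_nhds hs] with s' hs' using hRA s' hs'
    rw [he.deriv_eq, h.deriv]
    simp
    ring
  have hZ1 : ∀ s : ℝ, 0 < s → deriv Z s = 2 * s * deriv B (s ^ 2) := fun s hs => by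
    have h := (hd1 hBc (s ^ 2) (by positivity)).comp s (hpow s)
    have he : Z =ᶠ[nhds s] B ∘ fun s => s ^ 2 := by
      filter_upwards [lt_mem_nhds hs] with s' hs' using hZB s' hs'
    rw [he.deriv_eq, h.deriv]
    ring
  have hR2 : ∀ s : ℝ, 0 < s → deriv (deriv R) s =
      6 * s * deriv A (s ^ 2) + 4 * s ^ 3 * deriv (deriv A) (s ^ 2) := fun s hs => by
    have h := ((hd1 hAc (s ^ 2) (by positivity)).comp s (hpow s)).add
      (((hpow s).const_mul 2).mul ((hd2 hAc (s ^ 2) (by positivity)).comp s (hpow s)))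
    have he : deriv R =ᶠ[nhds s] (A ∘ fun s => s ^ 2) +
        (fun s => 2 * s ^ 2) * (deriv A ∘ fun s => s ^ 2) := by
      filter_upwards [lt_mem_nhds hs] with s' hs' using hR1 s' hs'
    rw [he.deriv_eq, h.deriv]
    simp
    ring
  have hZ2 : ∀ s : ℝ, 0 < s → deriv (deriv Z) s =
      2 * deriv B (s ^ 2) + 4 * s ^ 2 * deriv (deriv B) (s ^ 2) := fun s hs => by
    have h := ((hasDerivAt_id s).const_mul 2).mul
      ((hd2 hBc (s ^ 2) (by positivity)).comp s (hpow s))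
    have he : deriv Z =ᶠ[nhds s] (fun s => 2 * id s) * (deriv B ∘ fun s => s ^ 2) := by
      filter_upwards [lt_mem_nhds hs] with s' hs' using hZ1 s' hs'
    rw [he.deriv_eq, h.deriv]
    simp
    ring
  rw [hrot]
  exact helfrichDensity_rotMap a c₀ b
    (by filter_upwards [hev] with u hu using (hd1 hAc u hu).differentiableAt)
    (by filter_upwards [hev] with u hu using (hd1 hBc u hu).differentiableAt)
    (hd2 hAc _ hupos) (hd2 hBc _ hupos) hs hu.symm (by rw [← hu]; exact hRA _ hs)
    (by rw [← hu]; exact hR1 _ hs) (by rw [← hu]; exact hR2 _ hs) (by rw [← hu]; exact hZ1 _ hs)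
    (by rw [← hu]; exact hZ2 _ hs) hpos hw

/-! ### Reduction of the energy to one variable. -/

theorem boundary_energy {α β L r z : ℝ} {q : Space} {e : OrthonormalBasis (Fin 3) ℝ Space}
    {Y : Plane → Space} (hr : 0 < r)
    (hY : ∀ θ, Y (polar L θ) = q + comb e (r * Real.cos θ) (r * Real.sin θ) z) :
    (∫ θ in (0 : ℝ)..(2 * Real.pi),
        (α * curvatureSq (boundaryCurve L Y) θ + β) * ‖deriv (boundaryCurve L Y) θ‖) =
      2 * Real.pi * (α / r + β * r) := by
  have hcurve : boundaryCurve L Y =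
      fun θ => q + comb e (r * Real.cos θ) (r * Real.sin θ) z := funext hY
  have hd1 : deriv (boundaryCurve L Y) =
      fun θ => 0 + comb e (-(r * Real.sin θ)) (r * Real.cos θ) 0 := by
    funext θ
    rw [hcurve]
    have h := (((((Real.hasDerivAt_cos θ).const_mul r).smul_const (e 0)).add
      (((Real.hasDerivAt_sin θ).const_mul r).smul_const (e 1))).add_const (z • e 2)).const_add q
    refine h.deriv.trans ?_
    simp [comb]
  have hd2 : deriv (deriv (boundaryCurve L Y)) =
      fun θ => comb e (-(r * Real.cos θ)) (-(r * Real.sin θ)) 0 := by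
    funext θ
    rw [hd1]
    have h := (((((Real.hasDerivAt_sin θ).const_mul r).neg.smul_const (e 0)).add
      (((Real.hasDerivAt_cos θ).const_mul r).smul_const (e 1))).add_const ((0 : ℝ) • e 2)).const_add
        (0 : Space)
    refine h.deriv.trans ?_
    simp [comb]
  have hn : ∀ θ, ‖deriv (boundaryCurve L Y) θ‖ = r := fun θ => by
    have h : ‖deriv (boundaryCurve L Y) θ‖ ^ 2 = r ^ 2 := by
      simp only [hd1, zero_add, norm_sq_comb]
      linear_combination r ^ 2 * Real.sin_sq_add_cos_sq θ
    exact (pow_left_inj₀ (norm_nonneg _) hr.le two_ne_zero).1 h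
  have hk : ∀ θ, curvatureSq (boundaryCurve L Y) θ = 1 / r ^ 2 := fun θ => by
    rw [curvatureSq, hn, norm_sq_cross, hd2, hd1]
    simp only [zero_add, inner_comb]
    field_simp
    linear_combination r ^ 4 * (Real.sin θ ^ 2 + Real.cos θ ^ 2 + 1) * Real.sin_sq_add_cos_sq θ
  simp only [hn, hk]
  rw [intervalIntegral.integral_const, smul_eq_mul]
  field_simp
  ring

theorem integral_annulus_norm {l L : ℝ} (hl : 0 < l) (hL : l ≤ L) (G : ℝ → ℝ) :
    ∫ p in disc L \ disc l, G ‖p‖ = 2 * Real.pi * ∫ s in l..L, s * G s := by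
  have h1 : (disc L \ disc l).indicator (fun p : Plane => G ‖p‖) =
      fun p => (Ioc l L).indicator G ‖p‖ := by
    funext p
    by_cases h : p ∈ disc L \ disc l
    · have h' : ‖p‖ ∈ Ioc l L := by simpa [disc, and_comm] using h
      rw [indicator_of_mem h, indicator_of_mem h']
    · have h' : ‖p‖ ∉ Ioc l L := fun h' => h (by simpa [disc, and_comm] using h')
      rw [indicator_of_notMem h, indicator_of_notMem h']
  have hmeas : MeasurableSet (disc L \ disc l) :=
    Metric.isClosed_closedBall.measurableSet.diff Metric.isClosed_closedBall.measurableSet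
  rw [← integral_indicator hmeas, h1, integral_fun_norm_addHaar]
  have h2 : ∀ y : ℝ, y ^ (Module.finrank ℝ Plane - 1) • (Ioc l L).indicator G y =
      (Ioc l L).indicator (fun s => s * G s) y := fun y => by
    by_cases h : y ∈ Ioc l L <;> simp [h]
  simp only [h2]
  rw [setIntegral_indicator measurableSet_Ioc, intervalIntegral.integral_of_le hL]
  have h3 : Ioi 0 ∩ Ioc l L = Ioc l L := inter_eq_right.2 fun s hs => hl.trans hs.1
  rw [h3, Measure.real, EuclideanSpace.volume_ball_fin_two]
  simp [ENNReal.toReal_ofReal Real.pi_pos.le]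
  ring

theorem contDiffAt_lagr {E : Type*} [NormedAddCommGroup E] [NormedSpace ℝ E] {n : WithTop ℕ∞}
    (a c b : ℝ) {r p d y e : E → ℝ} {x : E} (hr : ContDiffAt ℝ n r x) (hp : ContDiffAt ℝ n p x)
    (hd : ContDiffAt ℝ n d x) (hy : ContDiffAt ℝ n y x) (he : ContDiffAt ℝ n e x)
    (hpos : 0 < r x) (hw : 0 < p x ^ 2 + y x ^ 2) :
    ContDiffAt ℝ n (fun x => lagr a c b (r x) (p x) (d x) (y x) (e x)) x := by
  have hsq : ContDiffAt ℝ n (fun x => √(p x ^ 2 + y x ^ 2)) x :=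
    ((hp.pow 2).add (hy.pow 2)).sqrt hw.ne'
  have hsp : 0 < √(p x ^ 2 + y x ^ 2) := Real.sqrt_pos.2 hw
  have h1 : r x * ((p x ^ 2 + y x ^ 2) ^ 2 * √(p x ^ 2 + y x ^ 2)) ≠ 0 := by positivity
  have h2 : (p x ^ 2 + y x ^ 2) * √(p x ^ 2 + y x ^ 2) ≠ 0 := by positivity
  have h3 : p x ^ 2 + y x ^ 2 ≠ 0 := hw.ne'
  unfold lagr
  have hD : ContDiffAt ℝ n (fun x => p x * e x - y x * d x) x := (hp.mul he).sub (hy.mul hd)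
  have hW : ContDiffAt ℝ n (fun x => p x ^ 2 + y x ^ 2) x := (hp.pow 2).add (hy.pow 2)
  exact (((contDiffAt_const.mul ((((hD.mul hr).add (hy.mul hW)).pow 2).div
    (hr.mul ((hW.pow 2).mul hsq)) h1)).add
    (contDiffAt_const.mul (((hD.mul hr).div hW h3).add hy))).add
    (contDiffAt_const.mul (hr.mul hsq))).add
    (contDiffAt_const.mul ((hD.mul hy).div (hW.mul hsq) h2))

theorem contDiff_deriv_of_four {f : ℝ → ℝ} (hf : ContDiff ℝ 4 f) :
    ContDiff ℝ 3 (deriv f) ∧ ContDiff ℝ 2 (deriv (deriv f)) ∧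
      ContDiff ℝ 1 (deriv (deriv (deriv f))) := by
  have h3 : ContDiff ℝ 3 (deriv f) :=
    ContDiff.deriv' (n := 3) (by simpa [show (3 : WithTop ℕ∞) + 1 = 4 by norm_num] using hf)
  have h2 : ContDiff ℝ 2 (deriv (deriv f)) :=
    ContDiff.deriv' (n := 2) (by simpa [show (2 : WithTop ℕ∞) + 1 = 3 by norm_num] using h3)
  exact ⟨h3, h2, ContDiff.deriv' (n := 1)
    (by simpa [show (1 : WithTop ℕ∞) + 1 = 2 by norm_num] using h2)⟩

theorem contDiffAt_lagrAlong (a c b : ℝ) {R Z : ℝ → ℝ} (hR : ContDiff ℝ 4 R)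
    (hZ : ContDiff ℝ 4 Z) {s : ℝ} (hpos : 0 < R s) (hw : 0 < deriv R s ^ 2 + deriv Z s ^ 2) :
    ContDiffAt ℝ 2 (lagrAlong a c b R Z) s := by
  obtain ⟨hR1, hR2, -⟩ := contDiff_deriv_of_four hR
  obtain ⟨hZ1, hZ2, -⟩ := contDiff_deriv_of_four hZ
  exact contDiffAt_lagr a c b (hR.of_le (by norm_num)).contDiffAt
    (hR1.of_le (by norm_num)).contDiffAt hR2.contDiffAt (hZ1.of_le (by norm_num)).contDiffAt
    hZ2.contDiffAt hpos hw

theorem contDiff_pd {n m : WithTop ℕ∞} {Y : Plane → Space} (hY : ContDiff ℝ n Y) (h : m + 1 ≤ n)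
    (i : Fin 2) : ContDiff ℝ m (pd i Y) :=
  (hY.fderiv_right h).clm_apply contDiff_const

theorem continuous_cross {E : Type*} [TopologicalSpace E] {v w : E → Space} (hv : Continuous v)
    (hw : Continuous w) : Continuous fun x => cross (v x) (w x) := by
  have h : ∀ i : Fin 3, Continuous fun x => cross (v x) (w x) i := by
    have hv' : ∀ i : Fin 3, Continuous fun x => v x i := fun i => by fun_prop
    have hw' : ∀ i : Fin 3, Continuous fun x => w x i := fun i => by fun_prop
    intro i
    fin_cases i
    · simp only [Fin.zero_eta, cross_apply_zero]
      exact ((hv' 1).mul (hw' 2)).sub ((hv' 2).mul (hw' 1))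
    · simp only [Fin.mk_one, cross_apply_one]
      exact ((hv' 2).mul (hw' 0)).sub ((hv' 0).mul (hw' 2))
    · simp only [Fin.reduceFinMk, cross_apply_two]
      exact ((hv' 0).mul (hw' 1)).sub ((hv' 1).mul (hw' 0))
  exact (PiLp.continuous_toLp 2 _).comp (continuous_pi h)

/-- Equality in Cauchy–Schwarz would put a nonzero vector in the kernel of the differential. -/
theorem gramDet_pos_of_injective {Y : Plane → Space} {p : Plane}
    (h : Function.Injective (fderiv ℝ Y p)) : 0 < gramDet Y p := by
  have hcs : firstForm Y p 0 1 ^ 2 ≤ firstForm Y p 0 0 * firstForm Y p 1 1 := by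
    have := real_inner_mul_inner_self_le (pd 0 Y p) (pd 1 Y p)
    simpa [firstForm, sq] using this
  refine lt_of_le_of_ne (sub_nonneg.2 hcs) fun h0 => ?_
  have h1 : pd 1 Y p ≠ 0 := fun h1 => by
    have := h (a₁ := EuclideanSpace.single 1 1) (a₂ := 0) (by rw [map_zero]; exact h1)
    have := congrArg (fun v : Plane => v 1) this
    simp at this
  have hpos : 0 < firstForm Y p 1 1 := by
    rw [firstForm]; exact real_inner_self_pos.2 h1
  -- Chosen so that `‖dY v‖² = g₁₁ · gramDet`, while its first coordinate `g₁₁` is positive.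
  set v : Plane := firstForm Y p 1 1 • EuclideanSpace.single 0 1
    - firstForm Y p 0 1 • EuclideanSpace.single 1 1 with hv
  have hval : fderiv ℝ Y p v = firstForm Y p 1 1 • pd 0 Y p - firstForm Y p 0 1 • pd 1 Y p := by
    rw [hv, map_sub, map_smul, map_smul]; rfl
  have hzero : fderiv ℝ Y p v = 0 := by
    rw [hval, ← inner_self_eq_zero (𝕜 := ℝ)]
    have e0 : inner ℝ (pd 0 Y p) (pd 0 Y p) = firstForm Y p 0 0 := rfl
    have e1 : inner ℝ (pd 1 Y p) (pd 1 Y p) = firstForm Y p 1 1 := rfl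
    have e2 : inner ℝ (pd 0 Y p) (pd 1 Y p) = firstForm Y p 0 1 := rfl
    have e3 : inner ℝ (pd 1 Y p) (pd 0 Y p) = firstForm Y p 0 1 := real_inner_comm _ _
    simp only [inner_sub_left, inner_sub_right, real_inner_smul_left, real_inner_smul_right,
      e0, e1, e2, e3]
    rw [gramDet] at h0
    linear_combination (-firstForm Y p 1 1) * h0
  have := h (hzero.trans (map_zero _).symm)
  have := congrArg (fun v : Plane => v 0) this
  simp [hv] at this
  exact hpos.ne' this

/-- Used only for integrability on the inner disc, which allows the integral to be split. -/
theorem continuousOn_helfrichDensity (a c₀ b : ℝ) {Y : Plane → Space} {s : Set Plane}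
    (hY : ContDiff ℝ 4 Y) (h : ∀ p ∈ s, Function.Injective (fderiv ℝ Y p)) :
    ContinuousOn (helfrichDensity a c₀ b Y) s := by
  have h1 : ∀ i, ContDiff ℝ 3 (pd i Y) := fun i => contDiff_pd hY (by norm_num) i
  have h2 : ∀ i j, Continuous (pd i (pd j Y)) :=
    fun i j => (contDiff_pd (m := 2) (h1 j) (by norm_num) i).continuous
  have hF : ∀ i j, Continuous fun p => firstForm Y p i j :=
    fun i j => (h1 i).continuous.inner (h1 j).continuous
  have hG : Continuous (gramDet Y) := ((hF 0 0).mul (hF 1 1)).sub ((hF 0 1).pow 2)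
  have hG0 : ∀ p ∈ s, gramDet Y p ≠ 0 := fun p hp => (gramDet_pos_of_injective (h p hp)).ne'
  have hC : Continuous fun p => cross (pd 0 Y p) (pd 1 Y p) :=
    continuous_cross (h1 0).continuous (h1 1).continuous
  have hN : ContinuousOn (unitNormal Y) s := by
    refine ContinuousOn.smul (hC.norm.continuousOn.inv₀ fun p hp h0 => hG0 p hp ?_)
      hC.continuousOn
    rw [← norm_cross_pd, h0]; norm_num
  have hS : ∀ i j, ContinuousOn (fun p => secondForm Y p i j) s :=
    fun i j => (h2 i j).continuousOn.inner hN
  have hF' : ∀ i j, ContinuousOn (fun p => firstForm Y p i j) s := fun i j => (hF i j).continuousOn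
  have hH : ContinuousOn (meanCurvature Y) s := by
    refine ContinuousOn.div ?_ (continuousOn_const.mul hG.continuousOn)
      fun p hp => mul_ne_zero two_ne_zero (hG0 p hp)
    exact ((((hS 0 0).mul (hF' 1 1)).sub ((continuousOn_const.mul (hS 0 1)).mul (hF' 0 1)))).add
      ((hS 1 1).mul (hF' 0 0))
  have hK : ContinuousOn (gaussCurvature Y) s :=
    (((hS 0 0).mul (hS 1 1)).sub ((hS 0 1).pow 2)).div hG.continuousOn hG0
  exact ((continuousOn_const.mul ((hH.add continuousOn_const).pow 2)).add
    (continuousOn_const.mul hK)).mul hG.continuousOn.sqrt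

/-- The energy of a surface which is a surface of revolution outside of the disc of radius `l`. -/
theorem energy_eq (a c₀ b α β : ℝ) {l L : ℝ} (hl : 0 < l) (hL : l < L) {q : Space}
    {e : OrthonormalBasis (Fin 3) ℝ Space} {R Z : ℝ → ℝ} (hR : ContDiff ℝ 4 R)
    (hZ : ContDiff ℝ 4 Z) (hpos : ∀ s ∈ Icc l L, 0 < R s)
    (hw : ∀ s ∈ Icc l L, 0 < deriv R s ^ 2 + deriv Z s ^ 2) {X Y : Plane → Space}
    (hX : IntegrableOn (helfrichDensity a c₀ b X) (disc l))
    (hin : ∀ p ∈ disc l, Y =ᶠ[nhds p] X)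
    (hout : ∀ p, l < ‖p‖ → Y =ᶠ[nhds p] rotProfile q e R Z) :
    energy a c₀ b α β L Y = (∫ p in disc l, helfrichDensity a c₀ b X p) +
      2 * Real.pi * ((∫ s in l..L, lagrAlong a (frameSign e * c₀) b R Z s)
        + (α / R L + β * R L)) := by
  have hLpos : 0 < L := hl.trans hL
  have hmem : ∀ p ∈ disc L \ disc l, l < ‖p‖ ∧ ‖p‖ ≤ L := fun p hp => by
    simpa [disc, and_comm] using hp
  have hml : MeasurableSet (disc l) := Metric.isClosed_closedBall.measurableSet
  have hmA : MeasurableSet (disc L \ disc l) := Metric.isClosed_closedBall.measurableSet.diff hml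
  have hd : ∀ p ∈ disc L \ disc l, helfrichDensity a c₀ b Y p =
      (fun s => lagrAlong a (frameSign e * c₀) b R Z s / s) ‖p‖ := fun p hp => by
    obtain ⟨h1, h2⟩ := hmem p hp
    rw [helfrichDensity_congr (hout p h1)]
    exact helfrichDensity_rotProfile a c₀ b hR hZ (norm_pos_iff.1 (hl.trans h1))
      (hpos _ ⟨h1.le, h2⟩) (hw _ ⟨h1.le, h2⟩)
  have hi : ∀ p ∈ disc l, helfrichDensity a c₀ b Y p = helfrichDensity a c₀ b X p :=
    fun p hp => helfrichDensity_congr (hin p hp)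
  have hG : ContinuousOn (fun s => lagrAlong a (frameSign e * c₀) b R Z s / s) (Icc l L) :=
    fun s hs => ((contDiffAt_lagrAlong a _ b hR hZ (hpos s hs)
      (hw s hs)).continuousAt.div continuousAt_id (hl.trans_le hs.1).ne').continuousWithinAt
  have hint : IntegrableOn (fun p : Plane =>
      (fun s => lagrAlong a (frameSign e * c₀) b R Z s / s) ‖p‖) (disc L \ disc l) := by
    -- The closed annulus is used because it is compact and stays away from the singularity of `1 /
    -- s`.
    have hK : IsCompact (disc L \ Metric.ball (0 : Plane) l) :=
      (isCompact_closedBall 0 L).diff Metric.isOpen_ball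
    have hcont : ContinuousOn (fun p : Plane =>
        (fun s => lagrAlong a (frameSign e * c₀) b R Z s / s) ‖p‖)
        (disc L \ Metric.ball (0 : Plane) l) :=
      hG.comp continuous_norm.continuousOn fun p hp => by
        simpa [disc, and_comm] using hp
    refine (hcont.integrableOn_compact hK).mono_set ?_
    exact sdiff_subset_sdiff_right Metric.ball_subset_closedBall
  have hunion : disc L = disc l ∪ (disc L \ disc l) :=
    (union_sdiff_cancel (Metric.closedBall_subset_closedBall hL.le)).symm
  have hbulk : ∫ p in disc L, helfrichDensity a c₀ b Y p =
      (∫ p in disc l, helfrichDensity a c₀ b X p) +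
        2 * Real.pi * ∫ s in l..L, lagrAlong a (frameSign e * c₀) b R Z s := by
    rw [hunion, setIntegral_union disjoint_sdiff_right hmA
      (hX.congr_fun (fun p hp => (hi p hp).symm) hml)
      (hint.congr_fun (fun p hp => (hd p hp).symm) hmA), setIntegral_congr_fun hml hi,
      setIntegral_congr_fun hmA hd, integral_annulus_norm hl hL.le
        (fun s => lagrAlong a (frameSign e * c₀) b R Z s / s)]
    congr 2
    refine intervalIntegral.integral_congr fun s hs => ?_
    rw [uIcc_of_le hL.le] at hs
    have : s ≠ 0 := (hl.trans_le hs.1).ne'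
    field_simp
  have hnorm : ∀ θ, ‖polar L θ‖ = L := fun θ => by
    have h : ‖polar L θ‖ ^ 2 = L ^ 2 := by
      rw [norm_sq_eq_usq]
      simp only [usq, polar, PiLp.toLp_apply, Matrix.cons_val_zero, Matrix.cons_val_one]
      linear_combination L ^ 2 * Real.sin_sq_add_cos_sq θ
    exact (pow_left_inj₀ (norm_nonneg _) hLpos.le two_ne_zero).1 h
  have hbdry := boundary_energy (α := α) (β := β) (L := L) (z := Z L) (q := q) (e := e) (Y := Y)
    (hpos L ⟨hL.le, le_rfl⟩) fun θ => by
      rw [(hout (polar L θ) (by rw [hnorm]; exact hL)).eq_of_nhds, rotProfile, hnorm]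
      congr 2
      · simp [polar]; field_simp
      · simp [polar]; field_simp
  have : energy a c₀ b α β L Y = (∫ p in disc L, helfrichDensity a c₀ b Y p) +
      ∫ θ in (0 : ℝ)..(2 * Real.pi),
        (α * curvatureSq (boundaryCurve L Y) θ + β) * ‖deriv (boundaryCurve L Y) θ‖ := rfl
  rw [this, hbulk, hbdry]
  ring

/-! ### The profile curve and its extension. -/

theorem hasDerivAt_vec {R Z : ℝ → ℝ} {r z s : ℝ} (hR : HasDerivAt R r s) (hZ : HasDerivAt Z z s) :
    HasDerivAt (fun s => (!₂[R s, Z s] : Plane)) !₂[r, z] s := by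
  have hv : ∀ x y : ℝ, (!₂[x, y] : Plane) =
      x • EuclideanSpace.single 0 1 + y • EuclideanSpace.single 1 1 := fun x y => by
    ext i; fin_cases i <;> simp
  simp only [hv]
  exact (hR.smul_const _).add (hZ.smul_const _)

theorem norm_sq_vec (x y : ℝ) : ‖(!₂[x, y] : Plane)‖ ^ 2 = x ^ 2 + y ^ 2 := by
  rw [norm_sq_eq_usq]; simp [usq]

theorem exists_polar (p : Plane) : ∃ θ, p = polar ‖p‖ θ := by
  have hn : ‖(⟨p 0, p 1⟩ : ℂ)‖ = ‖p‖ := by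
    rw [norm_eq_sqrt_usq, Complex.norm_def, Complex.normSq_mk, usq, sq, sq]
  refine ⟨Complex.arg ⟨p 0, p 1⟩, ?_⟩
  ext i
  fin_cases i
  · simpa [polar, hn] using (Complex.norm_mul_cos_arg ⟨p 0, p 1⟩).symm
  · simpa [polar, hn] using (Complex.norm_mul_sin_arg ⟨p 0, p 1⟩).symm

theorem norm_polar {s : ℝ} (hs : 0 ≤ s) (θ : ℝ) : ‖polar s θ‖ = s := by
  have h : ‖polar s θ‖ ^ 2 = s ^ 2 := by
    rw [polar, norm_sq_vec]
    linear_combination s ^ 2 * Real.sin_sq_add_cos_sq θ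
  exact (pow_left_inj₀ (norm_nonneg _) hs two_ne_zero).1 h

/-- `(ρ, ζ)` is a `C⁴` extension to the real line of the profile of the disc `X`, parametrized by
arc length on `[0, L]`. -/
structure IsProfile (L : ℝ) (X : Plane → Space) (q : Space)
    (e : OrthonormalBasis (Fin 3) ℝ Space) (ρ ζ : ℝ → ℝ) : Prop where
  contDiff_r : ContDiff ℝ 4 ρ
  contDiff_z : ContDiff ℝ 4 ζ
  eq_rot : ∀ p, p ≠ 0 → ‖p‖ ≤ L → X p = rotProfile q e ρ ζ p
  pos : ∀ s ∈ Ioc 0 L, 0 < ρ s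
  speed : ∀ s ∈ Icc 0 L, deriv ρ s ^ 2 + deriv ζ s ^ 2 = 1

/-- No regularity of `γ` is assumed. Restricting the `C⁴` map `X` to the line `θ = 0` and taking
coordinates in the frame gives `C⁴` functions on all of `ℝ` that agree with `γ` on `[0, L]`. Beyond
`L` they need not have unit speed. -/
theorem IsAxiallySymmetricDisc.exists_profile {L : ℝ} {γ : ℝ → Plane} {X : Plane → Space}
    (hX : IsAxiallySymmetricDisc L γ X) : ∃ q e ρ ζ, IsProfile L X q e ρ ζ ∧
      (∀ s ∈ Icc 0 L, derivWithin γ (Icc 0 L) s = !₂[deriv ρ s, deriv ζ s]) ∧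
      ∀ s ∈ Icc 0 L, profileCurvatureSq L γ s = deriv (deriv ρ) s ^ 2 + deriv (deriv ζ) s ^ 2 := by
  obtain ⟨q, e, hrot⟩ := hX.rotation
  have hL := hX.immersed.pos
  have hrot' : ∀ σ ∈ Icc 0 L, ∀ θ : ℝ, X (polar σ θ) =
      q + comb e (γ σ 0 * Real.cos θ) (γ σ 0 * Real.sin θ) (γ σ 1) := fun σ hσ θ => by
    rw [hrot σ hσ θ, comb]; abel
  have hpc : ContDiff ℝ 4 fun x : ℝ => X (polar x 0) := by
    have hv : (fun x : ℝ => polar x 0) = fun x => x • (EuclideanSpace.single 0 1 : Plane) := by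
      funext x; ext i; fin_cases i <;> simp [polar]
    refine hX.immersed.contDiff.comp ?_
    rw [hv]
    fun_prop
  set ρ : ℝ → ℝ := fun x => inner ℝ (comb e 1 0 0) (X (polar x 0) - q) with hρ
  set ζ : ℝ → ℝ := fun x => inner ℝ (comb e 0 0 1) (X (polar x 0) - q) with hζ
  have hρc : ContDiff ℝ 4 ρ := contDiff_const.inner ℝ (hpc.sub contDiff_const)
  have hζc : ContDiff ℝ 4 ζ := contDiff_const.inner ℝ (hpc.sub contDiff_const)
  have hργ : ∀ s ∈ Icc 0 L, ρ s = γ s 0 := fun s hs => by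
    simp only [hρ, hrot' s hs, add_sub_cancel_left, inner_comb]; simp
  have hζγ : ∀ s ∈ Icc 0 L, ζ s = γ s 1 := fun s hs => by
    simp only [hζ, hrot' s hs, add_sub_cancel_left, inner_comb]; simp
  have hud : UniqueDiffOn ℝ (Icc 0 L) := uniqueDiffOn_Icc hL
  have hd : ∀ {f : ℝ → ℝ} {n : WithTop ℕ∞}, ContDiff ℝ n f → n ≠ 0 → ∀ s,
      HasDerivAt f (deriv f s) s :=
    fun hf hn s => ((hf.differentiable hn) s).hasDerivAt
  have hγ : ∀ s ∈ Icc 0 L, γ s = !₂[ρ s, ζ s] := fun s hs => by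
    ext i; fin_cases i <;> simp [hργ s hs, hζγ s hs]
  have hγ1 : ∀ s ∈ Icc 0 L, derivWithin γ (Icc 0 L) s = !₂[deriv ρ s, deriv ζ s] := fun s hs =>
    (((hasDerivAt_vec (hd hρc (by norm_num) s) (hd hζc (by norm_num) s)).hasDerivWithinAt).congr
      hγ (hγ s hs)).derivWithin (hud s hs)
  have hγ2 : ∀ s ∈ Icc 0 L, derivWithin (derivWithin γ (Icc 0 L)) (Icc 0 L) s =
      !₂[deriv (deriv ρ) s, deriv (deriv ζ) s] := fun s hs =>
    (((hasDerivAt_vec (hd (contDiff_deriv_of_four hρc).1 (by norm_num) s)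
      (hd (contDiff_deriv_of_four hζc).1 (by norm_num) s)).hasDerivWithinAt).congr
      hγ1 (hγ1 s hs)).derivWithin (hud s hs)
  refine ⟨q, e, ρ, ζ, ⟨hρc, hζc, ?_, ?_, ?_⟩, hγ1, ?_⟩
  · intro p hp hpL
    obtain ⟨θ, hθ⟩ := exists_polar p
    have hn : 0 < ‖p‖ := norm_pos_iff.2 hp
    have hmem : ‖p‖ ∈ Icc 0 L := ⟨hn.le, hpL⟩
    have h0 : p 0 = ‖p‖ * Real.cos θ := by conv_lhs => rw [hθ]; simp [polar]
    have h1 : p 1 = ‖p‖ * Real.sin θ := by conv_lhs => rw [hθ]; simp [polar]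
    rw [rotProfile, h0, h1, hργ _ hmem, hζγ _ hmem]
    conv_lhs => rw [hθ, hrot' _ hmem]
    congr 2
    · field_simp
    · field_simp
  · intro s hs
    have hmem : s ∈ Icc 0 L := ⟨hs.1.le, hs.2⟩
    -- If the profile met the axis at `s > 0`, a whole parameter circle would be sent to one point
    -- and the differential would kill its tangent vector.
    refine lt_of_le_of_ne (by rw [hργ s hmem]; exact hX.halfPlane s hmem) fun h0 => ?_
    have hc : (fun θ => X (polar s θ)) = fun _ => q + comb e 0 0 (γ s 1) := by
      funext θ
      rw [hrot' s hmem, ← hργ s hmem, ← h0, zero_mul, zero_mul]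
    have hp : HasDerivAt (fun θ => polar s θ) (!₂[s * -Real.sin 0, s * Real.cos 0]) 0 :=
      hasDerivAt_vec ((Real.hasDerivAt_cos 0).const_mul s) ((Real.hasDerivAt_sin 0).const_mul s)
    have hXd : HasFDerivAt X (fderiv ℝ X (polar s 0)) (polar s 0) :=
      (hX.immersed.contDiff.differentiable (by norm_num) _).hasFDerivAt
    have hcomp := hXd.comp_hasDerivAt 0 hp
    have h1 := hcomp.unique ((hasDerivAt_const (0 : ℝ)
      (q + comb e 0 0 (γ s 1))).congr_of_eventuallyEq (Filter.Eventually.of_forall fun θ => congrFun hc θ))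
    have hdisc : polar s 0 ∈ disc L := by
      simpa [disc, norm_polar hs.1.le] using hs.2
    have h2 := hX.immersed.immersion _ hdisc (h1.trans (map_zero _).symm)
    have h3 := congrArg (fun v : Plane => v 1) h2
    simp at h3
    exact hs.1.ne' h3
  · intro s hs
    rw [← norm_sq_vec, ← hγ1 s hs, hX.arcLength s hs, one_pow]
  · intro s hs
    rw [profileCurvatureSq, hγ2 s hs, norm_sq_vec]

/-! ### Axially symmetric variations supported near the boundary. -/

/-- The variation which replaces the profile `(ρ, ζ)` by `(R t, Z t)` near the boundary. -/
def axialVariation (L : ℝ) (X : Plane → Space) (q : Space)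
    (e : OrthonormalBasis (Fin 3) ℝ Space) (R Z : ℝ → ℝ → ℝ) (t : ℝ) (p : Plane) : Space :=
  open Classical in if ‖p‖ < 3 * L / 4 then X p else rotProfile q e (R t) (Z t) p

section
variable {L : ℝ} {X : Plane → Space} {q : Space} {e : OrthonormalBasis (Fin 3) ℝ Space}
  {ρ ζ : ℝ → ℝ} {R Z : ℝ → ℝ → ℝ}

theorem axialVariation_of_lt {t : ℝ} {p : Plane} (hp : ‖p‖ < 3 * L / 4) :
    axialVariation L X q e R Z t p = X p := if_pos hp

theorem axialVariation_of_pos (hprof : IsProfile L X q e ρ ζ) (hL : 0 < L)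
    (hRin : ∀ t s, s < 3 * L / 4 → R t s = ρ s) (hZin : ∀ t s, s < 3 * L / 4 → Z t s = ζ s)
    {t : ℝ} {p : Plane} (hp : p ≠ 0) :
    axialVariation L X q e R Z t p = rotProfile q e (R t) (Z t) p := by
  by_cases h : ‖p‖ < 3 * L / 4
  · rw [axialVariation_of_lt h, hprof.eq_rot p hp (by linarith), rotProfile, rotProfile,
      hRin t _ h, hZin t _ h]
  · exact if_neg h

/-- Near the origin the family is `X` itself, and off the origin it is `rotProfile`, which is smooth
where `‖p‖` is. The two descriptions agree for `0 < ‖p‖ < 3L/4`. -/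
theorem isVariation_axialVariation (himm : IsImmersedDisc L X) (hprof : IsProfile L X q e ρ ζ)
    (hR : ContDiff ℝ 4 fun x : ℝ × ℝ => R x.1 x.2) (hZ : ContDiff ℝ 4 fun x : ℝ × ℝ => Z x.1 x.2)
    (hRin : ∀ t s, s < 3 * L / 4 → R t s = ρ s) (hZin : ∀ t s, s < 3 * L / 4 → Z t s = ζ s)
    (hR0 : ∀ s, R 0 s = ρ s) (hZ0 : ∀ s, Z 0 s = ζ s) :
    IsVariation L X (axialVariation L X q e R Z) := by
  have hL := himm.pos
  refine ⟨contDiff_iff_contDiffAt.2 fun x => ?_, fun p hp => ?_⟩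
  · by_cases h : x.2 = 0
    · have hev : ∀ᶠ y : ℝ × Plane in nhds x, ‖y.2‖ < 3 * L / 4 :=
        (continuous_snd.norm).continuousAt.eventually_lt continuousAt_const
          (by rw [h, norm_zero]; positivity)
      refine (himm.contDiff.comp contDiff_snd).contDiffAt.congr_of_eventuallyEq ?_
      filter_upwards [hev] with y hy using axialVariation_of_lt hy
    · have hev : ∀ᶠ y : ℝ × Plane in nhds x, y.2 ≠ 0 :=
        continuous_snd.continuousAt.eventually_ne h
      have hn : ContDiffAt ℝ 4 (fun y : ℝ × Plane => ‖y.2‖) x :=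
        (contDiffAt_norm ℝ h).comp x contDiff_snd.contDiffAt
      have hRc : ContDiffAt ℝ 4 (fun y : ℝ × Plane => R y.1 ‖y.2‖) x :=
        hR.contDiffAt.comp (f := fun y : ℝ × Plane => (y.1, ‖y.2‖)) x
          (contDiff_fst.contDiffAt.prodMk hn)
      have hZc : ContDiffAt ℝ 4 (fun y : ℝ × Plane => Z y.1 ‖y.2‖) x :=
        hZ.contDiffAt.comp (f := fun y : ℝ × Plane => (y.1, ‖y.2‖)) x
          (contDiff_fst.contDiffAt.prodMk hn)
      have hp : ∀ i : Fin 2, ContDiffAt ℝ 4 (fun y : ℝ × Plane => y.2 i) x := fun i =>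
        ((EuclideanSpace.proj i : Plane →L[ℝ] ℝ).contDiff.comp contDiff_snd).contDiffAt
      have hq := hRc.div hn (norm_ne_zero_iff.2 h)
      refine ContDiffAt.congr_of_eventuallyEq (f := fun y : ℝ × Plane =>
        rotProfile q e (R y.1) (Z y.1) y.2) ?_ ?_
      · exact contDiffAt_const.add ((((hq.mul (hp 0)).smul contDiffAt_const).add
          ((hq.mul (hp 1)).smul contDiffAt_const)).add (hZc.smul contDiffAt_const))
      · filter_upwards [hev] with y hy using axialVariation_of_pos hprof hL hRin hZin hy
  · by_cases h : p = 0
    · exact axialVariation_of_lt (by rw [h, norm_zero]; positivity)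
    · rw [axialVariation_of_pos hprof hL hRin hZin h, hprof.eq_rot p h (by simpa [disc] using hp),
        rotProfile, rotProfile, hR0, hZ0]

/-- The cut is made at `L / 2 < 3L/4`, so that the variation equals `X` on a neighbourhood of each
point of the inner disc. -/
theorem energy_axialVariation (a c₀ b α β : ℝ) (himm : IsImmersedDisc L X)
    (hprof : IsProfile L X q e ρ ζ)
    (hRin : ∀ t s, s < 3 * L / 4 → R t s = ρ s) (hZin : ∀ t s, s < 3 * L / 4 → Z t s = ζ s)
    {t : ℝ} (hR : ContDiff ℝ 4 (R t)) (hZ : ContDiff ℝ 4 (Z t))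
    (hpos : ∀ s ∈ Icc (L / 2) L, 0 < R t s)
    (hw : ∀ s ∈ Icc (L / 2) L, 0 < deriv (R t) s ^ 2 + deriv (Z t) s ^ 2) :
    energy a c₀ b α β L (axialVariation L X q e R Z t) =
      (∫ p in disc (L / 2), helfrichDensity a c₀ b X p) +
      2 * Real.pi * ((∫ s in (L / 2)..L, lagrAlong a (frameSign e * c₀) b (R t) (Z t) s)
        + (α / R t L + β * R t L)) := by
  have hL := himm.pos
  refine energy_eq (q := q) a c₀ b α β (by positivity) (by linarith) hR hZ hpos hw ?_ ?_ ?_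
  · refine (continuousOn_helfrichDensity a c₀ b himm.contDiff fun p hp =>
      himm.immersion p ?_).integrableOn_compact (isCompact_closedBall 0 (L / 2))
    exact Metric.closedBall_subset_closedBall (by linarith) hp
  · intro p hp
    have hp' : ‖p‖ ≤ L / 2 := by simpa [disc] using hp
    have hev : ∀ᶠ y : Plane in nhds p, ‖y‖ < 3 * L / 4 :=
      continuous_norm.continuousAt.eventually_lt continuousAt_const (by linarith)
    filter_upwards [hev] with y hy using axialVariation_of_lt hy
  · intro p hp
    have hev : ∀ᶠ y : Plane in nhds p, y ≠ 0 :=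
      isOpen_ne.mem_nhds (norm_pos_iff.1 ((half_pos hL).trans hp))
    filter_upwards [hev] with y hy using axialVariation_of_pos hprof hL hRin hZin hy

end

/-! ### Differentiation under the integral and natural boundary conditions. -/

theorem hasDerivAt_integral_of_contDiffAt {F : ℝ × ℝ → ℝ} {l L : ℝ} (hlL : l ≤ L)
    (hF : ∀ s ∈ Icc l L, ContDiffAt ℝ 1 F (0, s)) :
    HasDerivAt (fun t => ∫ s in l..L, F (t, s)) (∫ s in l..L, fderiv ℝ F (0, s) (1, 0)) 0 := by
  -- Compactness of `[l, L]` gives one range of `t` valid for every `s`, and then a uniform bound on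
  -- the derivative.
  have hev : ∀ᶠ t in nhds (0 : ℝ), ∀ s ∈ Icc l L, ContDiffAt ℝ 1 F (t, s) :=
    isCompact_Icc.eventually_forall_of_forall_eventually
      (P := fun t s => ContDiffAt ℝ 1 F (t, s)) fun s hs => (hF s hs).eventually (by simp)
  obtain ⟨ε, hε, hball⟩ := Metric.eventually_nhds_iff_ball.1 hev
  have hsub : ∀ t ∈ Metric.closedBall (0 : ℝ) (ε / 2), t ∈ Metric.ball (0 : ℝ) ε := fun t ht =>
    Metric.closedBall_subset_ball (by linarith) ht
  have hcd : ∀ x ∈ Metric.closedBall (0 : ℝ) (ε / 2) ×ˢ Icc l L, ContDiffAt ℝ 1 F x :=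
    fun x hx => hball x.1 (hsub _ hx.1) x.2 hx.2
  have hcont : ContinuousOn (fun x => fderiv ℝ F x (1, 0))
      (Metric.closedBall (0 : ℝ) (ε / 2) ×ˢ Icc l L) := fun x hx =>
    (((hcd x hx).continuousAt_fderiv (by norm_num)).clm_apply
      continuousAt_const).continuousWithinAt
  obtain ⟨M, hM⟩ := ((isCompact_closedBall (0 : ℝ) (ε / 2)).prod
    isCompact_Icc).exists_bound_of_continuousOn hcont
  have hpair : ∀ t ∈ Metric.closedBall (0 : ℝ) (ε / 2), ∀ s ∈ Icc l L,
      ((t, s) : ℝ × ℝ) ∈ Metric.closedBall (0 : ℝ) (ε / 2) ×ˢ Icc l L := fun t ht s hs => ⟨ht, hs⟩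
  have h0 : (0 : ℝ) ∈ Metric.closedBall (0 : ℝ) (ε / 2) :=
    Metric.mem_closedBall_self (by positivity)
  have hFc : ∀ t ∈ Metric.closedBall (0 : ℝ) (ε / 2), ContinuousOn (fun s => F (t, s)) (Icc l L) :=
    fun t ht s hs => ((hcd _ (hpair t ht s hs)).continuousAt.comp (f := fun s => (t, s))
      (by fun_prop)).continuousWithinAt
  have hF'c : ContinuousOn (fun s => fderiv ℝ F (0, s) (1, 0)) (Icc l L) :=
    hcont.comp (by fun_prop) fun s hs => hpair 0 h0 s hs
  have hI : uIoc l L ⊆ Icc l L := by rw [uIoc_of_le hlL]; exact Ioc_subset_Icc_self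
  refine (intervalIntegral.hasDerivAt_integral_of_dominated_loc_of_deriv_le
    (F := fun t s => F (t, s)) (F' := fun t s => fderiv ℝ F (t, s) (1, 0)) (bound := fun _ => M)
    (s := Metric.closedBall (0 : ℝ) (ε / 2)) (Metric.closedBall_mem_nhds _ (by positivity))
    ?_ ?_ ?_ ?_ ?_ ?_).2
  · filter_upwards [Metric.closedBall_mem_nhds (0 : ℝ) (half_pos hε)] with t ht
    exact ((hFc t ht).mono hI).aestronglyMeasurable measurableSet_uIoc
  · exact ContinuousOn.intervalIntegrable (by rw [uIcc_of_le hlL]; exact hFc 0 h0)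
  · exact (hF'c.mono hI).aestronglyMeasurable measurableSet_uIoc
  · exact Filter.Eventually.of_forall fun s hs t ht => hM _ (hpair t ht s (hI hs))
  · exact intervalIntegrable_const
  · refine Filter.Eventually.of_forall fun s hs t ht => ?_
    have h1 := ((hcd _ (hpair t ht s (hI hs))).differentiableAt (by norm_num)).hasFDerivAt
    exact h1.comp_hasDerivAt t ((hasDerivAt_id t).prodMk (hasDerivAt_const t s))

/-- A smooth cut-off which vanishes for `s ≤ m` and is equal to `1` near `L`. -/
def cutoff (m L s : ℝ) : ℝ := Real.smoothTransition (2 * (s - m) / (L - m))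

section
variable {m L : ℝ}

theorem contDiff_cutoff {n : ℕ∞} : ContDiff ℝ n (cutoff m L) := by
  refine Real.smoothTransition.contDiff.comp ?_
  exact (contDiff_const.mul (contDiff_id.sub contDiff_const)).div_const _

theorem cutoff_of_le (hm : m < L) {s : ℝ} (hs : s ≤ m) : cutoff m L s = 0 :=
  Real.smoothTransition.zero_of_nonpos
    (div_nonpos_of_nonpos_of_nonneg (by linarith) (by linarith))

theorem cutoff_eventuallyEq_one (hm : m < L) : cutoff m L =ᶠ[nhds L] fun _ => 1 := by
  filter_upwards [lt_mem_nhds (show (m + L) / 2 < L by linarith)] with s hs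
  refine Real.smoothTransition.one_of_one_le ?_
  rw [le_div_iff₀ (by linarith)]
  linarith

end

/-- Integration by parts leaves the Euler–Lagrange integrand `g` and boundary terms in `ψ(L)` and
`ψ'(L)`. Test functions supported in `(m, L)` force `g = 0` there; then `ψ(L)` and `ψ'(L)` can be
prescribed independently. -/
theorem natural_boundary_conditions {l m L B : ℝ} (hl : l < m) (hm : m < L) {f₀ f₁ f₂ : ℝ → ℝ}
    (h₀ : ContinuousOn f₀ (Icc l L)) (h₁ : ∀ s ∈ Icc l L, ContDiffAt ℝ 1 f₁ s)
    (h₂ : ∀ s ∈ Icc l L, ContDiffAt ℝ 2 f₂ s)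
    (h : ∀ ψ : ℝ → ℝ, ContDiff ℝ 4 ψ → (∀ s < m, ψ s = 0) →
      (∫ s in l..L, f₀ s * ψ s + f₁ s * deriv ψ s + f₂ s * deriv (deriv ψ) s) + B * ψ L = 0) :
    f₂ L = 0 ∧ f₁ L - deriv f₂ L + B = 0 := by
  have hlL : l ≤ L := (hl.trans hm).le
  have huI : uIcc l L = Icc l L := uIcc_of_le hlL
  have hd₁ : ∀ s ∈ uIcc l L, HasDerivAt f₁ (deriv f₁ s) s := fun s hs =>
    ((h₁ s (huI ▸ hs)).differentiableAt (by norm_num)).hasDerivAt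
  have hd₂ : ∀ s ∈ uIcc l L, HasDerivAt f₂ (deriv f₂ s) s := fun s hs =>
    ((h₂ s (huI ▸ hs)).differentiableAt (by norm_num)).hasDerivAt
  have hc₂ : ∀ s ∈ Icc l L, ContDiffAt ℝ 1 (deriv f₂) s := fun s hs =>
    (h₂ s hs).derivWithin (by norm_num)
  have hd₂' : ∀ s ∈ uIcc l L, HasDerivAt (deriv f₂) (deriv (deriv f₂) s) s := fun s hs =>
    ((hc₂ s (huI ▸ hs)).differentiableAt (by norm_num)).hasDerivAt
  have c₁ : ContinuousOn f₁ (uIcc l L) := fun s hs => (hd₁ s hs).continuousAt.continuousWithinAt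
  have c₂ : ContinuousOn f₂ (uIcc l L) := fun s hs => (hd₂ s hs).continuousAt.continuousWithinAt
  have c₁' : ContinuousOn (deriv f₁) (uIcc l L) := fun s hs =>
    (((h₁ s (huI ▸ hs)).derivWithin (m := 0) (by norm_num)).continuousAt).continuousWithinAt
  have c₂' : ContinuousOn (deriv f₂) (uIcc l L) :=
    fun s hs => (hd₂' s hs).continuousAt.continuousWithinAt
  have c₂'' : ContinuousOn (deriv (deriv f₂)) (uIcc l L) := fun s hs =>
    (((hc₂ s (huI ▸ hs)).derivWithin (m := 0) (by norm_num)).continuousAt).continuousWithinAt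
  have c₀ : ContinuousOn f₀ (uIcc l L) := huI ▸ h₀
  set g : ℝ → ℝ := fun s => f₀ s - deriv f₁ s + deriv (deriv f₂) s with hg
  have cg : ContinuousOn g (uIcc l L) := (c₀.sub c₁').add c₂''
  have key : ∀ ψ : ℝ → ℝ, ContDiff ℝ 4 ψ → (∀ s < m, ψ s = 0) →
      (∫ s in l..L, g s * ψ s) + f₂ L * deriv ψ L + (f₁ L - deriv f₂ L + B) * ψ L = 0 := by
    intro ψ hψ hz
    have hzl : ψ =ᶠ[nhds l] fun _ => 0 := by
      filter_upwards [gt_mem_nhds hl] with s hs using hz s hs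
    have z0 : ψ l = 0 := hz l hl
    have z1 : deriv ψ l = 0 := by rw [hzl.deriv_eq]; simp
    obtain ⟨hψ1, hψ2, -⟩ := contDiff_deriv_of_four hψ
    have e1 : ∀ s ∈ uIcc l L, HasDerivAt ψ (deriv ψ s) s := fun s _ =>
      (hψ.differentiable (by norm_num) s).hasDerivAt
    have e2 : ∀ s ∈ uIcc l L, HasDerivAt (deriv ψ) (deriv (deriv ψ) s) s := fun s _ =>
      (hψ1.differentiable (by norm_num) s).hasDerivAt
    have k0 := hψ.continuous.continuousOn (s := uIcc l L)
    have k1 := hψ1.continuous.continuousOn (s := uIcc l L)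
    have k2 := hψ2.continuous.continuousOn (s := uIcc l L)
    have i1 := intervalIntegral.integral_mul_deriv_eq_deriv_mul hd₁ e1
      c₁'.intervalIntegrable k1.intervalIntegrable
    have i2 := intervalIntegral.integral_mul_deriv_eq_deriv_mul hd₂ e2
      c₂'.intervalIntegrable k2.intervalIntegrable
    have i3 := intervalIntegral.integral_mul_deriv_eq_deriv_mul hd₂' e1
      c₂''.intervalIntegrable k1.intervalIntegrable
    have hψint := h ψ hψ hz
    have a0 : IntervalIntegrable (fun s => f₀ s * ψ s) volume l L :=
      (c₀.mul k0).intervalIntegrable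
    have a1 : IntervalIntegrable (fun s => f₁ s * deriv ψ s) volume l L :=
      (c₁.mul k1).intervalIntegrable
    have a2 : IntervalIntegrable (fun s => f₂ s * deriv (deriv ψ) s) volume l L :=
      (c₂.mul k2).intervalIntegrable
    have b1 : IntervalIntegrable (fun s => deriv f₁ s * ψ s) volume l L :=
      (c₁'.mul k0).intervalIntegrable
    have b2 : IntervalIntegrable (fun s => deriv (deriv f₂) s * ψ s) volume l L :=
      (c₂''.mul k0).intervalIntegrable
    have hsplit : ∫ s in l..L, f₀ s * ψ s + f₁ s * deriv ψ s + f₂ s * deriv (deriv ψ) s =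
        (∫ s in l..L, f₀ s * ψ s) + (∫ s in l..L, f₁ s * deriv ψ s)
          + ∫ s in l..L, f₂ s * deriv (deriv ψ) s := by
      rw [← intervalIntegral.integral_add a0 a1, ← intervalIntegral.integral_add (a0.add a1) a2]
    rw [hsplit] at hψint
    have hgi : ∫ s in l..L, g s * ψ s = (∫ s in l..L, f₀ s * ψ s)
        - (∫ s in l..L, deriv f₁ s * ψ s) + ∫ s in l..L, deriv (deriv f₂) s * ψ s := by
      rw [← intervalIntegral.integral_sub a0 b1, ← intervalIntegral.integral_add (a0.sub b1) b2]
      congr 1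
      funext s
      simp only [hg]
      ring
    rw [hgi]
    rw [z0] at i1 i3
    rw [z1] at i2
    linear_combination hψint - i1 - i2 + i3
  have hae : ∀ᵐ s, s ∈ Ioo m L → g s = 0 := by
    refine isOpen_Ioo.ae_eq_zero_of_integral_contDiff_smul_eq_zero ?_ fun ψ hψ _ hsupp => ?_
    · refine ContinuousOn.locallyIntegrableOn (cg.mono ?_) measurableSet_Ioo
      rw [huI]
      exact fun s hs => ⟨(hl.trans hs.1).le, hs.2.le⟩
    · have hz : ∀ s, s ∉ Ioo m L → ψ s = 0 := fun s hs =>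
        image_eq_zero_of_notMem_tsupport fun hs' => hs (hsupp hs')
      have hL : ψ L = 0 := hz L (by simp)
      have hL' : deriv ψ L = 0 := by
        by_contra hne
        have : L ∈ tsupport ψ := support_deriv_subset (f := ψ) hne
        exact absurd (hsupp this) (by simp)
      have hk := key ψ (by exact_mod_cast contDiff_infty.1 hψ 4) fun s hs =>
        hz s fun hs' => absurd hs'.1 hs.le.not_gt
      rw [hL, hL', mul_zero, mul_zero, add_zero, add_zero,
        intervalIntegral.integral_of_le hlL] at hk
      rw [← hk, ← integral_indicator measurableSet_Ioc]
      refine integral_congr_ae (Filter.Eventually.of_forall fun s => ?_)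
      simp only [smul_eq_mul]
      by_cases hs : s ∈ Ioc l L
      · rw [indicator_of_mem hs, mul_comm]
      · rw [indicator_of_notMem hs, hz s fun hs' => hs ⟨hl.trans hs'.1, hs'.2.le⟩, zero_mul]
  have hint : ∀ ψ : ℝ → ℝ, (∀ s < m, ψ s = 0) → ∫ s in l..L, g s * ψ s = 0 := by
    intro ψ hz
    refine intervalIntegral.integral_zero_ae ?_
    filter_upwards [hae, compl_mem_ae_iff.2 (measure_singleton m),
      compl_mem_ae_iff.2 (measure_singleton L)] with s hs hsm hsL hmem
    rw [uIoc_of_le hlL] at hmem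
    rcases lt_trichotomy s m with h1 | h1 | h1
    · rw [hz s h1, mul_zero]
    · exact absurd h1 hsm
    · rw [hs ⟨h1, lt_of_le_of_ne hmem.2 hsL⟩, zero_mul]
  have hcut : ContDiff ℝ 4 (cutoff m L) := contDiff_cutoff (n := 4)
  have hone := cutoff_eventuallyEq_one hm
  have hone' : HasDerivAt (cutoff m L) 0 L :=
    (hasDerivAt_const L (1 : ℝ)).congr_of_eventuallyEq hone
  -- Test function with `ψ(L) = 1`, `ψ'(L) = 0`.
  have t1 := key (cutoff m L) hcut fun s hs => cutoff_of_le hm hs.le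
  rw [hint _ fun s hs => cutoff_of_le hm hs.le, hone'.deriv, hone.eq_of_nhds] at t1
  have hz2 : ∀ s < m, (s - L) * cutoff m L s = 0 := fun s hs => by
    rw [cutoff_of_le hm hs.le, mul_zero]
  -- Test function with `ψ(L) = 0`, `ψ'(L) = 1`.
  have t2 := key (fun s => (s - L) * cutoff m L s)
    ((contDiff_id.sub contDiff_const).mul hcut) hz2
  have hd2 : HasDerivAt (fun s => (s - L) * cutoff m L s) 1 L := by
    have := ((hasDerivAt_id L).sub_const L).mul hone'
    refine this.congr_deriv ?_
    simp [hone.eq_of_nhds]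
  rw [hint _ hz2, hd2.deriv, sub_self, zero_mul] at t2
  exact ⟨by linarith, by linarith⟩

/-! ### Differentiation and reparametrization of the reduced Lagrangian. -/

/-- Unit speed is required only at `x`. The lemma serves twice: along `t` for the first variation
and along `s` for the derivative of `lagr` on the profile. -/
theorem hasDerivAt_lagr (a c b : ℝ) {r p d y e : ℝ → ℝ} {r₁ p₁ d₁ y₁ e₁ x : ℝ}
    (hr : HasDerivAt r r₁ x) (hp : HasDerivAt p p₁ x) (hd : HasDerivAt d d₁ x)
    (hy : HasDerivAt y y₁ x) (he : HasDerivAt e e₁ x) (hpos : 0 < r x)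
    (hw : p x ^ 2 + y x ^ 2 = 1) {w₁ D D₁ : ℝ} (hw₁ : w₁ = 2 * (p x * p₁ + y x * y₁))
    (hD : D = p x * e x - y x * d x)
    (hD₁ : D₁ = p₁ * e x + p x * e₁ - y₁ * d x - y x * d₁) :
    HasDerivAt (fun x => lagr a c b (r x) (p x) (d x) (y x) (e x))
      (a / 4 * (2 * (D * r x + y x) * (D₁ * r x + D * r₁ + y₁ + y x * w₁) / r x
          - (D * r x + y x) ^ 2 * (r₁ + 5 / 2 * r x * w₁) / r x ^ 2)
        + a * c * (D₁ * r x + D * r₁ - D * r x * w₁ + y₁)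
        + a * c ^ 2 * (r₁ + r x * w₁ / 2)
        + b * (D₁ * y x + D * y₁ - 3 / 2 * D * y x * w₁)) x := by
  have hDd : HasDerivAt (fun x => p x * e x - y x * d x) D₁ x := by
    refine ((hp.mul he).sub (hy.mul hd)).congr_deriv ?_
    rw [hD₁]; ring
  have hWd : HasDerivAt (fun x => p x ^ 2 + y x ^ 2) w₁ x := by
    refine ((hp.pow 2).add (hy.pow 2)).congr_deriv ?_
    rw [hw₁]; push_cast; ring
  have hw0 : p x ^ 2 + y x ^ 2 ≠ 0 := by rw [hw]; norm_num
  have hSd : HasDerivAt (fun x => √(p x ^ 2 + y x ^ 2)) (w₁ / 2) x := by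
    refine (hWd.sqrt hw0).congr_deriv ?_
    simp only [hw, Real.sqrt_one, mul_one]
  have n1 : r x * ((p x ^ 2 + y x ^ 2) ^ 2 * √(p x ^ 2 + y x ^ 2)) ≠ 0 := by
    rw [hw]; simpa using hpos.ne'
  have n2 : (p x ^ 2 + y x ^ 2) * √(p x ^ 2 + y x ^ 2) ≠ 0 := by rw [hw]; simp
  have t1 := (((((hDd.mul hr).add (hy.mul hWd)).pow 2).div
    (hr.mul ((hWd.pow 2).mul hSd)) n1).const_mul (a / 4))
  have t2 := ((((hDd.mul hr).div hWd hw0).add hy).const_mul (a * c))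
  have t3 := (hr.mul hSd).const_mul (a * c ^ 2)
  have t4 := ((hDd.mul hy).div (hWd.mul hSd) n2).const_mul b
  refine (((t1.add t2).add t3).add t4).congr_deriv ?_
  have hr0 := hpos.ne'
  simp only [Pi.add_apply, Pi.mul_apply, Pi.pow_apply, hw, ← hD, Real.sqrt_one]
  field_simp
  push_cast
  ring

/-- For a change of parameter `φ` take `k = φ'` and `j = φ''`. The terms in `j` cancel in `r'z'' -
z'r''`, which scales by `k³`. -/
theorem lagr_reparam (a c b d e j : ℝ) {r p y k : ℝ} (hk : 0 < k) (hr : 0 < r)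
    (hw : 0 < p ^ 2 + y ^ 2) :
    lagr a c b r (p * k) (d * k ^ 2 + p * j) (y * k) (e * k ^ 2 + y * j) =
      lagr a c b r p d y e * k := by
  have h1 : (p * k) ^ 2 + (y * k) ^ 2 = k ^ 2 * (p ^ 2 + y ^ 2) := by ring
  have h2 : √(k ^ 2 * (p ^ 2 + y ^ 2)) = k * √(p ^ 2 + y ^ 2) := by
    rw [Real.sqrt_mul (sq_nonneg k), Real.sqrt_sq hk.le]
  have h3 : p * k * (e * k ^ 2 + y * j) - y * k * (d * k ^ 2 + p * j) =
      k ^ 3 * (p * e - y * d) := by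
    ring
  simp only [lagr, h1, h2, h3]
  have hS : 0 < √(p ^ 2 + y ^ 2) := Real.sqrt_pos.2 hw
  generalize √(p ^ 2 + y ^ 2) = S at *
  generalize p ^ 2 + y ^ 2 = W at *
  field_simp

theorem deriv_deriv_add_mul {f ψ : ℝ → ℝ} (hf : ContDiff ℝ 4 f) (hψ : ContDiff ℝ 4 ψ) (t : ℝ) :
    deriv (fun s => f s + t * ψ s) = (fun s => deriv f s + t * deriv ψ s) ∧
    deriv (deriv fun s => f s + t * ψ s) =
      fun s => deriv (deriv f) s + t * deriv (deriv ψ) s := by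
  have h : ∀ {f ψ : ℝ → ℝ}, ContDiff ℝ 3 f → ContDiff ℝ 3 ψ →
      deriv (fun s => f s + t * ψ s) = fun s => deriv f s + t * deriv ψ s := fun hf hψ => by
    funext s
    exact ((hf.differentiable (by norm_num) s).hasDerivAt.add
      ((hψ.differentiable (by norm_num) s).hasDerivAt.const_mul t)).deriv
  have h1 := h (hf.of_le (by norm_num)) (hψ.of_le (by norm_num))
  exact ⟨h1, by rw [h1]; exact h (contDiff_deriv_of_four hf).1 (contDiff_deriv_of_four hψ).1⟩

/-- `∂L/∂r` of the reduced Lagrangian at unit speed. -/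
def lagrR (a c r p d y e : ℝ) : ℝ :=
  a / 2 * (((p * e - y * d) * r + y) * (p * e - y * d)) / r
    - a / 4 * ((p * e - y * d) * r + y) ^ 2 / r ^ 2 + a * c * (p * e - y * d) + a * c ^ 2

/-- `∂L/∂r'` of the reduced Lagrangian at unit speed. -/
def lagrP (a c b r p d y e : ℝ) : ℝ :=
  a / 2 * (((p * e - y * d) * r + y) * (e * r + 2 * y * p)) / r
    - 5 * a / 4 * (((p * e - y * d) * r + y) ^ 2 * p) / r
    + a * c * (e * r - 2 * (p * e - y * d) * r * p) + a * c ^ 2 * (r * p)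
    + b * (e * y - 3 * (p * e - y * d) * y * p)

/-- `∂L/∂r''` of the reduced Lagrangian at unit speed. -/
def lagrD (a c b r p d y e : ℝ) : ℝ :=
  -y * (a / 2 * ((p * e - y * d) * r + y) + a * c * r + b * y)

/-! ### First and second variation at the boundary. -/

section
variable {a c₀ b α β L : ℝ} {X : Plane → Space} {q : Space}
  {e : OrthonormalBasis (Fin 3) ℝ Space} {ρ ζ : ℝ → ℝ}

/-- The variation moves only the radius, `ρ + tψ`. The boundary coefficient is the derivative of
`α/r + βr` at `r = ρ(L)`. -/
theorem first_variation (himm : IsImmersedDisc L X) (hprof : IsProfile L X q e ρ ζ)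
    (hcrit : IsCritical a c₀ b α β L X) {ψ : ℝ → ℝ} (hψ : ContDiff ℝ 4 ψ)
    (hz : ∀ s < 3 * L / 4, ψ s = 0) :
    (∫ s in (L / 2)..L,
      lagrR a (frameSign e * c₀) (ρ s) (deriv ρ s) (deriv (deriv ρ) s) (deriv ζ s)
          (deriv (deriv ζ) s) * ψ s
        + lagrP a (frameSign e * c₀) b (ρ s) (deriv ρ s) (deriv (deriv ρ) s) (deriv ζ s)
          (deriv (deriv ζ) s) * deriv ψ s
        + lagrD a (frameSign e * c₀) b (ρ s) (deriv ρ s) (deriv (deriv ρ) s) (deriv ζ s)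
          (deriv (deriv ζ) s) * deriv (deriv ψ) s)
      + (β - α / ρ L ^ 2) * ψ L = 0 := by
  have hL := himm.pos
  have hρ := hprof.contDiff_r
  have hζ := hprof.contDiff_z
  obtain ⟨hρ1, hρ2, -⟩ := contDiff_deriv_of_four hρ
  obtain ⟨hζ1, hζ2, -⟩ := contDiff_deriv_of_four hζ
  obtain ⟨hψ1, hψ2, -⟩ := contDiff_deriv_of_four hψ
  have hpos : ∀ s ∈ Icc (L / 2) L, 0 < ρ s := fun s hs =>
    hprof.pos s ⟨by linarith [hs.1], hs.2⟩
  have hspeed : ∀ s ∈ Icc (L / 2) L, deriv ρ s ^ 2 + deriv ζ s ^ 2 = 1 := fun s hs =>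
    hprof.speed s ⟨by linarith [hs.1], hs.2⟩
  have hRc : ContDiff ℝ 4 fun x : ℝ × ℝ => (fun t s => ρ s + t * ψ s) x.1 x.2 :=
    (hρ.comp contDiff_snd).add (contDiff_fst.mul (hψ.comp contDiff_snd))
  have hZc : ContDiff ℝ 4 fun x : ℝ × ℝ => (fun _ s => ζ s : ℝ → ℝ → ℝ) x.1 x.2 :=
    hζ.comp contDiff_snd
  have hRin : ∀ t s, s < 3 * L / 4 → (fun t s => ρ s + t * ψ s) t s = ρ s := fun t s hs => by
    simp [hz s hs]
  have hZin : ∀ t s, s < 3 * L / 4 → (fun _ s => ζ s : ℝ → ℝ → ℝ) t s = ζ s :=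
    fun _ _ _ => rfl
  have hvar := isVariation_axialVariation himm hprof hRc hZc hRin hZin
    (fun s => by simp) (fun s => rfl)
  have hE := hcrit _ hvar
  set F : ℝ × ℝ → ℝ := fun x => lagr a (frameSign e * c₀) b (ρ x.2 + x.1 * ψ x.2)
    (deriv ρ x.2 + x.1 * deriv ψ x.2) (deriv (deriv ρ) x.2 + x.1 * deriv (deriv ψ) x.2)
    (deriv ζ x.2) (deriv (deriv ζ) x.2) with hFdef
  have hFc : ∀ s ∈ Icc (L / 2) L, ContDiffAt ℝ 1 F (0, s) := fun s hs => by
    have h : ∀ {f g : ℝ → ℝ}, ContDiff ℝ 1 f → ContDiff ℝ 1 g →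
        ContDiffAt ℝ 1 (fun x : ℝ × ℝ => f x.2 + x.1 * g x.2) (0, s) := fun hf hg =>
      ((hf.comp contDiff_snd).add (contDiff_fst.mul (hg.comp contDiff_snd))).contDiffAt
    refine contDiffAt_lagr a (frameSign e * c₀) b
      (h (hρ.of_le (by norm_num)) (hψ.of_le (by norm_num)))
      (h (hρ1.of_le (by norm_num)) (hψ1.of_le (by norm_num)))
      (h (hρ2.of_le (by norm_num)) (hψ2.of_le (by norm_num)))
      ((hζ1.of_le (by norm_num)).comp contDiff_snd).contDiffAt
      ((hζ2.of_le (by norm_num)).comp contDiff_snd).contDiffAt ?_ ?_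
    · simpa using hpos s hs
    · simp [hspeed s hs]
  have hFd : ∀ s ∈ Icc (L / 2) L, fderiv ℝ F (0, s) (1, 0) =
      lagrR a (frameSign e * c₀) (ρ s) (deriv ρ s) (deriv (deriv ρ) s) (deriv ζ s)
          (deriv (deriv ζ) s) * ψ s
        + lagrP a (frameSign e * c₀) b (ρ s) (deriv ρ s) (deriv (deriv ρ) s) (deriv ζ s)
          (deriv (deriv ζ) s) * deriv ψ s
        + lagrD a (frameSign e * c₀) b (ρ s) (deriv ρ s) (deriv (deriv ρ) s) (deriv ζ s)
          (deriv (deriv ζ) s) * deriv (deriv ψ) s := fun s hs => by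
    have h1 := (((hFc s hs).differentiableAt (by norm_num)).hasFDerivAt).comp_hasDerivAt (0 : ℝ)
      ((hasDerivAt_id (0 : ℝ)).prodMk (hasDerivAt_const (0 : ℝ) s))
    have hlin : ∀ k j : ℝ, HasDerivAt (fun t : ℝ => k + t * j) j 0 := fun k j => by
      simpa using ((hasDerivAt_id (0 : ℝ)).mul_const j).const_add k
    have hr := hpos s hs
    have h2 := hasDerivAt_lagr a (frameSign e * c₀) b (hlin (ρ s) (ψ s))
      (hlin (deriv ρ s) (deriv ψ s)) (hlin (deriv (deriv ρ) s) (deriv (deriv ψ) s))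
      (hasDerivAt_const (0 : ℝ) (deriv ζ s)) (hasDerivAt_const (0 : ℝ) (deriv (deriv ζ) s))
      (by simpa using hr) (by simpa using hspeed s hs) rfl rfl rfl
    refine (h1.unique h2).trans ?_
    simp only [lagrR, lagrP, lagrD, zero_mul, add_zero]
    field_simp
    ring
  have hev : ∀ᶠ t in nhds (0 : ℝ), ∀ s ∈ Icc (L / 2) L, 0 < ρ s + t * ψ s ∧
      0 < (deriv ρ s + t * deriv ψ s) ^ 2 + deriv ζ s ^ 2 := by
    refine isCompact_Icc.eventually_forall_of_forall_eventually
      (P := fun t s => 0 < ρ s + t * ψ s ∧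
        0 < (deriv ρ s + t * deriv ψ s) ^ 2 + deriv ζ s ^ 2) fun s hs => ?_
    have := hρ.continuous
    have := hρ1.continuous
    have := hζ1.continuous
    have := hψ.continuous
    have := hψ1.continuous
    have g1 : Continuous fun x : ℝ × ℝ => ρ x.2 + x.1 * ψ x.2 := by fun_prop
    have g2 : Continuous fun x : ℝ × ℝ =>
      (deriv ρ x.2 + x.1 * deriv ψ x.2) ^ 2 + deriv ζ x.2 ^ 2 := by fun_prop
    exact (g1.continuousAt.eventually (lt_mem_nhds (by simpa using hpos s hs))).and
      (g2.continuousAt.eventually (lt_mem_nhds (by simp [hspeed s hs])))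
  have hEq : (fun t => energy a c₀ b α β L
      (axialVariation L X q e (fun t s => ρ s + t * ψ s) (fun _ s => ζ s) t)) =ᶠ[nhds 0]
      fun t => (∫ p in disc (L / 2), helfrichDensity a c₀ b X p) +
        2 * Real.pi * ((∫ s in (L / 2)..L, F (t, s))
          + (α / (ρ L + t * ψ L) + β * (ρ L + t * ψ L))) := by
    filter_upwards [hev] with t ht
    obtain ⟨d1, d2⟩ := deriv_deriv_add_mul hρ hψ t
    rw [energy_axialVariation a c₀ b α β himm hprof hRin hZin
      (hρ.add (contDiff_const.mul hψ)) hζ (fun s hs => (ht s hs).1)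
      (fun s hs => by rw [d1]; exact (ht s hs).2)]
    rw [d1] at d2
    simp only [lagrAlong, d1, d2, hFdef]
  have hRL : ρ L + 0 * ψ L ≠ 0 := by
    simpa using (hpos L ⟨by linarith, le_rfl⟩).ne'
  have hlin : HasDerivAt (fun t : ℝ => ρ L + t * ψ L) (ψ L) 0 := by
    simpa using ((hasDerivAt_id (0 : ℝ)).mul_const (ψ L)).const_add (ρ L)
  have hD := ((((hasDerivAt_integral_of_contDiffAt (show L / 2 ≤ L by linarith) hFc).add
    (((hasDerivAt_const (0 : ℝ) α).div hlin hRL).add (hlin.const_mul β))).const_mul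
      (2 * Real.pi)).const_add (∫ p in disc (L / 2), helfrichDensity a c₀ b X p))
  have h0 := hE.unique (hD.congr_of_eventuallyEq hEq)
  have hint : ∫ s in (L / 2)..L, fderiv ℝ F (0, s) (1, 0) = _ :=
    intervalIntegral.integral_congr fun s hs => hFd s (by rwa [uIcc_of_le (by linarith)] at hs)
  rw [hint] at h0
  have h1 := (mul_eq_zero.1 h0.symm).resolve_left (by positivity)
  rw [← h1]
  simp only [zero_mul, add_zero]
  field_simp
  ring

theorem IsProfile.deriv_speed (hprof : IsProfile L X q e ρ ζ) (hL : 0 < L) :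
    deriv ρ L * deriv (deriv ρ) L + deriv ζ L * deriv (deriv ζ) L = 0 := by
  have hρ1 := (contDiff_deriv_of_four hprof.contDiff_r).1
  have hζ1 := (contDiff_deriv_of_four hprof.contDiff_z).1
  have h1 := (((hρ1.differentiable (by norm_num) L).hasDerivAt.pow 2).add
    -- Unit speed holds only up to `L`, so its constancy is differentiated from the left.
    ((hζ1.differentiable (by norm_num) L).hasDerivAt.pow 2)).hasDerivWithinAt (s := Icc 0 L)
  have hmem : L ∈ Icc 0 L := ⟨hL.le, le_rfl⟩
  have h2 := (hasDerivWithinAt_const L (Icc 0 L) (1 : ℝ)).congr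
    (f₁ := deriv ρ ^ 2 + deriv ζ ^ 2) (fun s hs => hprof.speed s hs) (hprof.speed L hmem)
  have h3 := (uniqueDiffOn_Icc hL L hmem).eq_deriv _ h1 h2
  simp at h3
  linarith

/-- At a vertical end point `ρ' = 0` and `ζ'' = 0`, so `lagrP` vanishes. The vanishing of `lagrD`,
divided by `-ζ'`, gives the first condition; the derivative of `lagrD` gives the second. -/
theorem boundary_conditions (himm : IsImmersedDisc L X) (hprof : IsProfile L X q e ρ ζ)
    (hcrit : IsCritical a c₀ b α β L X) (hvert : deriv ρ L = 0) :
    a / 2 * (-deriv ζ L * deriv (deriv ρ) L * ρ L + deriv ζ L) + a * (frameSign e * c₀) * ρ L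
        + b * deriv ζ L = 0 ∧
      β - α / ρ L ^ 2 = a / 2 * ρ L * deriv (deriv (deriv ρ)) L := by
  have hL := himm.pos
  have hρ := hprof.contDiff_r
  have hζ := hprof.contDiff_z
  obtain ⟨hρ1, hρ2, hρ3⟩ := contDiff_deriv_of_four hρ
  obtain ⟨hζ1, hζ2, hζ3⟩ := contDiff_deriv_of_four hζ
  have hpos : ∀ s ∈ Icc (L / 2) L, 0 < ρ s := fun s hs =>
    hprof.pos s ⟨by linarith [hs.1], hs.2⟩
  have hz1 : deriv ζ L ^ 2 = 1 := by
    simpa [hvert] using hprof.speed L ⟨hL.le, le_rfl⟩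
  have hz1' : deriv ζ L ≠ 0 := fun h => by rw [h] at hz1; norm_num at hz1
  have hz2 : deriv (deriv ζ) L = 0 := by
    simpa [hvert, hz1'] using hprof.deriv_speed hL
  have smooth : ∀ s ∈ Icc (L / 2) L, ∀ n : WithTop ℕ∞, n ≤ 2 → ContDiffAt ℝ n ρ s ∧
      ContDiffAt ℝ n (deriv ρ) s ∧ ContDiffAt ℝ n (deriv (deriv ρ)) s ∧
      ContDiffAt ℝ n (deriv ζ) s ∧ ContDiffAt ℝ n (deriv (deriv ζ)) s := fun s _ n hn =>
    ⟨(hρ.of_le (hn.trans (by norm_num))).contDiffAt,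
      (hρ1.of_le (hn.trans (by norm_num))).contDiffAt,
      (hρ2.of_le hn).contDiffAt, (hζ1.of_le (hn.trans (by norm_num))).contDiffAt,
      (hζ2.of_le hn).contDiffAt⟩
  have hR : ContinuousOn (fun s => lagrR a (frameSign e * c₀) (ρ s) (deriv ρ s) (deriv (deriv ρ) s)
      (deriv ζ s) (deriv (deriv ζ) s)) (Icc (L / 2) L) := by
    intro s hs
    obtain ⟨k0, k1, k2, k3, k4⟩ := smooth s hs 0 (by norm_num)
    have := (hpos s hs).ne'
    have k0 := k0.continuousAt
    have k1 := k1.continuousAt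
    have k2 := k2.continuousAt
    have k3 := k3.continuousAt
    have k4 := k4.continuousAt
    refine ContinuousAt.continuousWithinAt ?_
    unfold lagrR
    fun_prop (disch := positivity)
  have hP : ∀ s ∈ Icc (L / 2) L, ContDiffAt ℝ 1 (fun s =>
      lagrP a (frameSign e * c₀) b (ρ s) (deriv ρ s) (deriv (deriv ρ) s)
      (deriv ζ s) (deriv (deriv ζ) s)) s := by
    intro s hs
    obtain ⟨k0, k1, k2, k3, k4⟩ := smooth s hs 1 (by norm_num)
    have := (hpos s hs).ne'
    unfold lagrP
    fun_prop (disch := assumption)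
  have hD : ∀ s ∈ Icc (L / 2) L, ContDiffAt ℝ 2 (fun s =>
      lagrD a (frameSign e * c₀) b (ρ s) (deriv ρ s) (deriv (deriv ρ) s)
      (deriv ζ s) (deriv (deriv ζ) s)) s := by
    intro s hs
    obtain ⟨k0, k1, k2, k3, k4⟩ := smooth s hs 2 le_rfl
    unfold lagrD
    fun_prop
  obtain ⟨hA, hB⟩ := natural_boundary_conditions (B := β - α / ρ L ^ 2)
    (show L / 2 < 3 * L / 4 by linarith) (by linarith) hR hP hD
    fun ψ hψ hz => first_variation himm hprof hcrit hψ hz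
  have hd : HasDerivAt (fun s => lagrD a (frameSign e * c₀) b (ρ s) (deriv ρ s)
      (deriv (deriv ρ) s) (deriv ζ s) (deriv (deriv ζ) s))
      (a / 2 * ρ L * deriv (deriv (deriv ρ)) L) L := by
    have d0 := (hρ.differentiable (by norm_num) L).hasDerivAt
    have d1 := (hρ1.differentiable (by norm_num) L).hasDerivAt
    have d2 := (hρ2.differentiable (by norm_num) L).hasDerivAt
    have e1 := (hζ1.differentiable (by norm_num) L).hasDerivAt
    have e2 := (hζ2.differentiable (by norm_num) L).hasDerivAt
    have := e1.neg.mul ((((((d1.mul e2).sub (e1.mul d2)).mul d0).add e1).const_mul (a / 2)).add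
      (d0.const_mul (a * (frameSign e * c₀))) |>.add (e1.const_mul b))
    refine this.congr_deriv ?_
    simp only [Pi.add_apply, Pi.mul_apply, Pi.sub_apply, Pi.neg_apply, hvert, hz2]
    -- Only the `ρ'''` term survives, with the factor `ζ'² = 1`.
    linear_combination (a / 2 * ρ L * deriv (deriv (deriv ρ)) L) * hz1
  rw [hd.deriv] at hB
  simp only [lagrD, lagrP, hvert, hz2] at hA hB
  refine ⟨?_, ?_⟩
  · have := (mul_eq_zero.1 hA).resolve_left (neg_ne_zero.2 hz1')
    linear_combination this
  · simp only [mul_zero, zero_mul, add_zero, sub_zero, zero_div, zero_sub] at hB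
    linear_combination hB

/-- Reparametrizing by `s + tη(s)` traces the same extended profile up to `L + t`, so the energy
becomes an explicit function of the upper limit. -/
theorem second_variation (himm : IsImmersedDisc L X) (hprof : IsProfile L X q e ρ ζ)
    (hstable : IsStable a c₀ b α β L X) (hvert : deriv ρ L = 0) :
    0 ≤ deriv (lagrAlong a (frameSign e * c₀) b ρ ζ) L
      + (β - α / ρ L ^ 2) * deriv (deriv ρ) L := by
  have hL := himm.pos
  have hρ := hprof.contDiff_r
  have hζ := hprof.contDiff_z
  obtain ⟨hρ1, hρ2, -⟩ := contDiff_deriv_of_four hρ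
  obtain ⟨hζ1, hζ2, -⟩ := contDiff_deriv_of_four hζ
  have hpos : ∀ s ∈ Icc (L / 2) L, 0 < ρ s := fun s hs =>
    hprof.pos s ⟨by linarith [hs.1], hs.2⟩
  have hspeed : ∀ s ∈ Icc (L / 2) L, deriv ρ s ^ 2 + deriv ζ s ^ 2 = 1 := fun s hs =>
    hprof.speed s ⟨by linarith [hs.1], hs.2⟩
  have hm : 3 * L / 4 < L := by linarith
  set η : ℝ → ℝ := cutoff (3 * L / 4) L with hη
  have hηc : ContDiff ℝ 4 η := contDiff_cutoff (n := 4)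
  have hηz : ∀ s < 3 * L / 4, η s = 0 := fun s hs => cutoff_of_le hm hs.le
  have hηL : η L = 1 := (cutoff_eventuallyEq_one hm).eq_of_nhds
  obtain ⟨hη1, hη2, -⟩ := contDiff_deriv_of_four hηc
  have hfam : ∀ {f : ℝ → ℝ}, ContDiff ℝ 4 f →
      ContDiff ℝ 4 fun x : ℝ × ℝ => (fun t s => f (s + t * η s)) x.1 x.2 := fun hf =>
    hf.comp (contDiff_snd.add (contDiff_fst.mul (hηc.comp contDiff_snd)))
  have hin : ∀ (f : ℝ → ℝ) (t s : ℝ), s < 3 * L / 4 → (fun t s => f (s + t * η s)) t s = f s :=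
    fun f t s hs => by simp [hηz s hs]
  have hvar := isVariation_axialVariation himm hprof (hfam hρ) (hfam hζ) (hin ρ) (hin ζ)
    (fun s => by simp) (fun s => by simp)
  have hE := hstable _ hvar
  have hφ : ∀ t s, HasDerivAt (fun s => s + t * η s) (1 + t * deriv η s) s := fun t s =>
    (hasDerivAt_id s).add ((hηc.differentiable (by norm_num) s).hasDerivAt.const_mul t)
  have hφ' : ∀ t s, HasDerivAt (fun s => 1 + t * deriv η s) (t * deriv (deriv η) s) s :=
    fun t s => ((hη1.differentiable (by norm_num) s).hasDerivAt.const_mul t).const_add 1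
  have hd1 : ∀ {f : ℝ → ℝ}, ContDiff ℝ 4 f → ∀ t, deriv (fun s => f (s + t * η s)) =
      fun s => deriv f (s + t * η s) * (1 + t * deriv η s) := fun hf t => by
    funext s
    exact ((hf.differentiable (by norm_num) _).hasDerivAt.comp s (hφ t s)).deriv
  have hd2 : ∀ {f : ℝ → ℝ}, ContDiff ℝ 4 f → ∀ t, deriv (deriv fun s => f (s + t * η s)) =
      fun s => deriv (deriv f) (s + t * η s) * (1 + t * deriv η s) ^ 2
        + deriv f (s + t * η s) * (t * deriv (deriv η) s) := fun hf t => by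
    funext s
    rw [hd1 hf]
    have := (((contDiff_deriv_of_four hf).1.differentiable (by norm_num) _).hasDerivAt.comp s
      (hφ t s)).mul (hφ' t s)
    refine this.deriv.trans ?_
    simp only [Function.comp]
    ring
  set f := lagrAlong a (frameSign e * c₀) b ρ ζ with hf
  -- The integral runs slightly past `L`, where unit speed may fail; on this open set `lagr` is
  -- still smooth.
  set O : Set ℝ := {s | 0 < ρ s ∧ 0 < deriv ρ s ^ 2 + deriv ζ s ^ 2} with hO
  have hOopen : IsOpen O :=
    (isOpen_lt continuous_const hρ.continuous).inter (isOpen_lt continuous_const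
      ((hρ1.continuous.pow 2).add (hζ1.continuous.pow 2)))
  have hOI : ∀ s ∈ Icc (L / 2) L, s ∈ O := fun s hs => ⟨hpos s hs, by rw [hspeed s hs]; norm_num⟩
  have hfO : ∀ s ∈ O, ContDiffAt ℝ 2 f s := fun s hs =>
    contDiffAt_lagrAlong a _ b hρ hζ hs.1 hs.2
  have hfc : ContinuousOn f O := fun s hs => (hfO s hs).continuousAt.continuousWithinAt
  have hmemL : L ∈ Icc (L / 2) L := ⟨by linarith, le_rfl⟩
  have hev : ∀ᶠ t in nhds (0 : ℝ), ∀ s ∈ Icc (L / 2) L, 0 < 1 + t * deriv η s ∧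
      s + t * η s ∈ O := by
    refine isCompact_Icc.eventually_forall_of_forall_eventually
      (P := fun t s => 0 < 1 + t * deriv η s ∧ s + t * η s ∈ O) fun s hs => ?_
    have := hηc.continuous
    have := hη1.continuous
    have g1 : Continuous fun x : ℝ × ℝ => 1 + x.1 * deriv η x.2 := by fun_prop
    have g2 : Continuous fun x : ℝ × ℝ => x.2 + x.1 * η x.2 := by fun_prop
    exact (g1.continuousAt.eventually (lt_mem_nhds (by simp))).and
      (g2.continuousAt.eventually (hOopen.mem_nhds (by simpa using hOI s hs)))
  have hEq : (fun t => energy a c₀ b α β L (axialVariation L X q e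
      (fun t s => ρ (s + t * η s)) (fun t s => ζ (s + t * η s)) t)) =ᶠ[nhds 0]
      fun t => (∫ p in disc (L / 2), helfrichDensity a c₀ b X p) +
        2 * Real.pi * ((∫ s in (L / 2)..(L + t), f s)
          + (α / ρ (L + t) + β * ρ (L + t))) := by
    filter_upwards [hev] with t ht
    have hcomp : ∀ {f : ℝ → ℝ}, ContDiff ℝ 4 f → ContDiff ℝ 4 fun s => f (s + t * η s) :=
      fun hf => hf.comp (contDiff_id.add (contDiff_const.mul hηc))
    rw [energy_axialVariation a c₀ b α β himm hprof (hin ρ) (hin ζ) (hcomp hρ) (hcomp hζ)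
      (fun s hs => (ht s hs).2.1) (fun s hs => by
        have h1 := (ht s hs).1
        have h2 := (ht s hs).2.2
        simp only [hd1 hρ, hd1 hζ]
        rw [mul_pow, mul_pow, ← add_mul]
        positivity)]
    have hI : ∫ s in (L / 2)..L, lagrAlong a (frameSign e * c₀) b (fun s => ρ (s + t * η s))
        (fun s => ζ (s + t * η s)) s =
        ∫ s in (L / 2)..L, (f ∘ fun s => s + t * η s) s * (1 + t * deriv η s) := by
      refine intervalIntegral.integral_congr fun s hs => ?_
      rw [uIcc_of_le (by linarith)] at hs
      have r2 := congrFun (hd2 hρ t) s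
      have z2 := congrFun (hd2 hζ t) s
      have r1 := congrFun (hd1 hρ t) s
      have z1 := congrFun (hd1 hζ t) s
      simp only [lagrAlong]
      rw [r2, z2, r1, z1]
      exact lagr_reparam _ _ _ _ _ _ (ht s hs).1 (ht s hs).2.1 (ht s hs).2.2
    rw [hI, intervalIntegral.integral_comp_mul_deriv' (fun s _ => hφ t s)
      (by have := hη1.continuous; fun_prop) (hfc.mono ?_)]
    · rw [hηL, hηz (L / 2) (by linarith)]
      simp
    · rintro _ ⟨s, hs, rfl⟩
      rw [uIcc_of_le (by linarith)] at hs
      exact (ht s hs).2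
  have hρd : ∀ s, HasDerivAt ρ (deriv ρ s) s := fun s =>
    (hρ.differentiable (by norm_num) s).hasDerivAt
  have hnear : ∀ᶠ t in nhds (0 : ℝ), ∀ s ∈ uIcc (L / 2) (L + t), s ∈ O := by
    obtain ⟨ε, hε, hball⟩ := Metric.isOpen_iff.1 hOopen L (hOI L hmemL)
    filter_upwards [Metric.ball_mem_nhds (0 : ℝ) (lt_min hε (half_pos hL))] with t ht s hs
    have ht' : |t| < min ε (L / 2) := by simpa using ht
    obtain ⟨ht1, ht2⟩ := abs_lt.1 (ht'.trans_le (min_le_left _ _))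
    obtain ⟨ht3, ht4⟩ := abs_lt.1 (ht'.trans_le (min_le_right _ _))
    rw [uIcc_of_le (by linarith)] at hs
    rcases le_or_gt s L with h | h
    · exact hOI s ⟨hs.1, h⟩
    · refine hball ?_
      rw [Metric.mem_ball, Real.dist_eq, abs_lt]
      constructor <;> linarith [hs.2]
  have hshift : ∀ t : ℝ, HasDerivAt (fun t => L + t) 1 t := fun t =>
    (hasDerivAt_id t).const_add L
  have hD1 : ∀ᶠ t in nhds (0 : ℝ), HasDerivAt
      (fun t => (∫ p in disc (L / 2), helfrichDensity a c₀ b X p) +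
        2 * Real.pi * ((∫ s in (L / 2)..(L + t), f s) + (α / ρ (L + t) + β * ρ (L + t))))
      (2 * Real.pi * (f (L + t) + (-α * deriv ρ (L + t) / ρ (L + t) ^ 2
        + β * deriv ρ (L + t)))) t := by
    filter_upwards [hnear] with t ht
    have hmem : L + t ∈ O := ht _ right_mem_uIcc
    have h1 := intervalIntegral.integral_hasDerivAt_right (f := f) (a := L / 2) (b := L + t)
      (hfc.mono ht).intervalIntegrable (hfc.stronglyMeasurableAtFilter hOopen _ hmem)
      (hfO _ hmem).continuousAt
    have h2 := h1.comp t (hshift t)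
    have h3 := (hρd (L + t)).comp t (hshift t)
    have h4 := ((h2.add (((hasDerivAt_const t α).div h3 hmem.1.ne').add
      (h3.const_mul β))).const_mul (2 * Real.pi)).const_add
        (∫ p in disc (L / 2), helfrichDensity a c₀ b X p)
    refine h4.congr_deriv ?_
    simp only [Function.comp]
    ring
  -- The further term `2αρ'²/ρ³` drops out since `ρ'(L) = 0`.
  have hD2 : HasDerivAt (fun t => 2 * Real.pi * (f (L + t) + (-α * deriv ρ (L + t) / ρ (L + t) ^ 2
        + β * deriv ρ (L + t))))
      (2 * Real.pi * (deriv f L + (β - α / ρ L ^ 2) * deriv (deriv ρ) L)) 0 := by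
    have hL0 : L + 0 ∈ O := by rw [add_zero]; exact hOI L hmemL
    have h1 := (((hfO _ hL0).differentiableAt (by norm_num)).hasDerivAt).comp (0 : ℝ) (hshift 0)
    have h2 := (hρd (L + 0)).comp (0 : ℝ) (hshift 0)
    have h3 := ((hρ1.differentiable (by norm_num) (L + 0)).hasDerivAt).comp (0 : ℝ) (hshift 0)
    have h4 := ((h1.add (((h3.const_mul (-α)).div (h2.pow 2)
      (pow_ne_zero 2 hL0.1.ne')).add (h3.const_mul β))).const_mul (2 * Real.pi))
    refine h4.congr_deriv ?_
    have := (hpos L hmemL).ne'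
    simp only [Function.comp, Pi.pow_apply, add_zero, hvert]
    field_simp
    ring
  have h2 : iteratedDeriv 2 (fun t => energy a c₀ b α β L (axialVariation L X q e
      (fun t s => ρ (s + t * η s)) (fun t s => ζ (s + t * η s)) t)) 0 =
      2 * Real.pi * (deriv f L + (β - α / ρ L ^ 2) * deriv (deriv ρ) L) := by
    -- `deriv` defaults to 0 where a function is not differentiable; `hD1` and `hD2` show that the
    -- derivatives here are genuine.
    rw [iteratedDeriv_succ, iteratedDeriv_one, hEq.deriv.deriv_eq]
    have : deriv (fun t => (∫ p in disc (L / 2), helfrichDensity a c₀ b X p) +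
        2 * Real.pi * ((∫ s in (L / 2)..(L + t), f s) + (α / ρ (L + t) + β * ρ (L + t))))
        =ᶠ[nhds 0] fun t => 2 * Real.pi * (f (L + t) + (-α * deriv ρ (L + t) / ρ (L + t) ^ 2
        + β * deriv ρ (L + t))) := by
      filter_upwards [hD1] with t ht using ht.deriv
    rw [this.deriv_eq, hD2.deriv]
  rw [h2] at hE
  exact nonneg_of_mul_nonneg_right hE (by positivity)

theorem curvature_nondecreasing (ha : 0 < a) (himm : IsImmersedDisc L X)
    (hprof : IsProfile L X q e ρ ζ) (hcrit : IsCritical a c₀ b α β L X)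
    (hstable : IsStable a c₀ b α β L X) (hvert : deriv ρ L = 0) :
    0 ≤ deriv (deriv ρ) L * deriv (deriv (deriv ρ)) L := by
  have hL := himm.pos
  have hρ := hprof.contDiff_r
  have hζ := hprof.contDiff_z
  obtain ⟨hρ1, hρ2, hρ3⟩ := contDiff_deriv_of_four hρ
  obtain ⟨hζ1, hζ2, hζ3⟩ := contDiff_deriv_of_four hζ
  have hposL : 0 < ρ L := hprof.pos L ⟨hL, le_rfl⟩
  have hspeed := hprof.speed L ⟨hL.le, le_rfl⟩
  have hz1 : deriv ζ L ^ 2 = 1 := by simpa [hvert] using hspeed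
  have hz1' : deriv ζ L ≠ 0 := fun h => by rw [h] at hz1; norm_num at hz1
  have hz2 : deriv (deriv ζ) L = 0 := by
    simpa [hvert, hz1'] using hprof.deriv_speed hL
  obtain ⟨hA, hB⟩ := boundary_conditions himm hprof hcrit hvert
  have hS := second_variation himm hprof hstable hvert
  have hd := hasDerivAt_lagr a (frameSign e * c₀) b
    (hρ.differentiable (by norm_num) L).hasDerivAt
    (hρ1.differentiable (by norm_num) L).hasDerivAt
    (hρ2.differentiable (by norm_num) L).hasDerivAt
    (hζ1.differentiable (by norm_num) L).hasDerivAt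
    (hζ2.differentiable (by norm_num) L).hasDerivAt hposL hspeed rfl rfl rfl
  -- The derivative is `-ζ'ρ'''` times the left side of the first boundary condition `hA`.
  have hzero : deriv (lagrAlong a (frameSign e * c₀) b ρ ζ) L = 0 := by
    refine hd.deriv.trans ?_
    simp only [hvert, hz2]
    field_simp
    linear_combination (-4 * deriv ζ L * deriv (deriv (deriv ρ)) L * ρ L ^ 2) * hA
  rw [hzero, zero_add, hB] at hS
  have : a / 2 * ρ L * (deriv (deriv ρ) L * deriv (deriv (deriv ρ)) L) ≥ 0 := by
    linarith
  exact nonneg_of_mul_nonneg_right this (by positivity)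

end

end EulerHelfrich

end

/-! ### The theorem. -/

theorem mainTheorem11 (a c₀ b α β : ℝ) (ha : 0 < a) (hα : 0 < α) (hβ : 0 < β)
    (L : ℝ) (γ : ℝ → EulerHelfrich.Plane) (X : EulerHelfrich.Plane → EulerHelfrich.Space)
    (hX : EulerHelfrich.IsAxiallySymmetricDisc L γ X)
    (hcrit : EulerHelfrich.IsCritical a c₀ b α β L X)
    (hstable : EulerHelfrich.IsStable a c₀ b α β L X)
    (hvert : derivWithin γ (Set.Icc 0 L) L 0 = 0) :
    ∃ m : ℝ, 0 ≤ m ∧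
      HasDerivWithinAt (EulerHelfrich.profileCurvatureSq L γ) m (Set.Icc 0 L) L := by
  obtain ⟨q, e, ρ, ζ, hprof, h1, h2⟩ := hX.exists_profile
  have hL := hX.immersed.pos
  have hmem : L ∈ Set.Icc 0 L := ⟨hL.le, le_rfl⟩
  have hvert' : deriv ρ L = 0 := by simpa [h1 L hmem] using hvert
  have hspeed : deriv ζ L ^ 2 = 1 := by simpa [hvert'] using hprof.speed L hmem
  have hz1 : deriv ζ L ≠ 0 := fun h => by rw [h] at hspeed; norm_num at hspeed
  have hz2 : deriv (deriv ζ) L = 0 := by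
    simpa [hvert', hz1] using hprof.deriv_speed hL
  have hmain := EulerHelfrich.curvature_nondecreasing ha hX.immersed hprof hcrit hstable hvert'
  obtain ⟨-, hρ2, -⟩ := EulerHelfrich.contDiff_deriv_of_four hprof.contDiff_r
  obtain ⟨-, hζ2, -⟩ := EulerHelfrich.contDiff_deriv_of_four hprof.contDiff_z
  -- This is the derivative of `ρ''² + ζ''²` at `L`, where `ζ''(L) = 0`.
  refine ⟨2 * (deriv (deriv ρ) L * deriv (deriv (deriv ρ)) L), by positivity, ?_⟩
  have hd := ((hρ2.differentiable (by norm_num) L).hasDerivAt.pow 2).add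
    ((hζ2.differentiable (by norm_num) L).hasDerivAt.pow 2)
  refine HasDerivWithinAt.congr (hd.hasDerivWithinAt.congr_deriv ?_) h2 (h2 L hmem)
  rw [hz2]
  push_cast
  ring
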